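/- \textbf{Shuffle Membership.} For languages $L_1,\dots,L_t\subseteq\Gamma^*$, the shuffle of $L_1,\dots,L_t$ is the set of all words $w\in\Gamma^*$ whose letters can be tagged with indices from $\{1,\dots,t\}$ such that, for every $i$, the subword of $w$ formed by the letters with tag $i$ lies in $L_i\cup\{\varepsilon\}$. The problem Shuffle Membership takes as input NFAs $B_1,\dots,B_t$ over a finite alphabet $\Gamma$, an integer $k$ and a word $w\in\Gamma^k$, and asks whether $w$ lies in the shuffle of $L(B_1),\dots,L(B_t)$. Let $b=\max_i |B_i|$, where $|B_i|$ is the number of states of $B_i$. Time is measured on a random access machine with words of $O(k+\log(t+b+|\Gamma|+1)+1)$ bits, whose memory initially holds $k$, $t$, $|\Gamma|$, $w$ and, for each $B_i$, its number of states, the characteristic vectors of its sets of initial and final states, and the table of its transition relation. Multiplying two integers of at most $\ell$ bits costs $\mathit{bc}(\ell)$, where $\mathit{bc}:\mathbb N\to\mathbb N_{\ge 1}$ is non-decreasing. Every other instruction (loading a constant, copying, addition, subtraction, indirect load, indirect store) and every test of the sign of a register costs $1$. \textbf{Theorem.} Shuffle Membership can be solved in time $$O\bigl(2^k\cdot t\cdot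 k\cdot(b^2+k\cdot \mathit{bc}(k))\bigr)$$ (and in time $O(1)$ if $k=0$ or $t=0$). That is, there are a program and constants, independent of $\mathit{bc}$ and of the input, such that on every input the program halts with the correct answer within this time bound. -/

import Mathlib

/-! ### Random access machines with charged multiplication -/

namespace RAM

/-- A configuration: registers and memory cells, both holding integers. -/
structure State where
  reg : ℕ → ℤ
  mem : ℕ → ℤ

/-- Elementary instructions; all arguments of type `ℕ` are names of registers. -/
inductive Instr
  | const (d : ℕ) (z : ℤ)
  | move (d a : ℕ)
  | add (d a b : ℕ)
  | sub (d a b : ℕ)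
  | mul (d a b : ℕ)
  /-- Register `d` receives the content of the cell whose address is in register `a`. -/
  | load (d a : ℕ)
  /-- The cell whose address is in register `a` receives the content of register `b`. -/
  | store (a b : ℕ)

/-- Write `v` to register `d`. This fails if `v` does not fit into a signed word of `W` bits
(plus sign). -/
def State.setReg (W : ℕ) (s : State) (d : ℕ) (v : ℤ) : Option State :=
  if v.natAbs < 2 ^ W then some { s with reg := Function.update s.reg d v } else none

/-- The effect of an instruction on a machine with word length `W`. The result `none` means that
the machine is stuck: a register overflows, or an address is negative. -/
def Instr.exec (W : ℕ) (s : State) : Instr → Option State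
  | .const d z => s.setReg W d z
  | .move d a => s.setReg W d (s.reg a)
  | .add d a b => s.setReg W d (s.reg a + s.reg b)
  | .sub d a b => s.setReg W d (s.reg a - s.reg b)
  | .mul d a b => s.setReg W d (s.reg a * s.reg b)
  | .load d a => if 0 ≤ s.reg a then s.setReg W d (s.mem (s.reg a).toNat) else none
  | .store a b =>
      if 0 ≤ s.reg a then
        some { s with mem := Function.update s.mem (s.reg a).toNat (s.reg b) }
      else none

/-- The cost of an instruction: a multiplication of two integers of at most `l` bits costs `bc l`,
every other instruction costs one. -/
def Instr.cost (bc : ℕ → ℕ) (s : State) : Instr → ℕ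
  | .mul _ a b => bc (max (s.reg a).natAbs.size (s.reg b).natAbs.size)
  | _ => 1

/-- Programs. Both branching and looping test whether the content of a register is positive. -/
inductive Prog
  | skip
  | instr (i : Instr)
  | seq (P Q : Prog)
  | ite (r : ℕ) (P Q : Prog)
  | loop (r : ℕ) (P : Prog)

/-- `P.Runs bc W s s' T`: on the machine with word length `W` and multiplication cost `bc`, the
program `P` started in `s` halts in `s'` without getting stuck, after time exactly `T`. Every test
costs one time unit. -/
inductive Prog.Runs (bc : ℕ → ℕ) (W : ℕ) : Prog → State → State → ℕ → Prop
  | skip (s : State) : Runs bc W .skip s s 0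
  | instr {i : Instr} {s s' : State} (h : i.exec W s = some s') :
      Runs bc W (.instr i) s s' (i.cost bc s)
  | seq {P Q : Prog} {s₁ s₂ s₃ : State} {T₁ T₂ : ℕ}
      (hP : Runs bc W P s₁ s₂ T₁) (hQ : Runs bc W Q s₂ s₃ T₂) :
      Runs bc W (.seq P Q) s₁ s₃ (T₁ + T₂)
  | ite_pos {r : ℕ} {P Q : Prog} {s s' : State} {T : ℕ} (hr : 0 < s.reg r)
      (hP : Runs bc W P s s' T) : Runs bc W (.ite r P Q) s s' (1 + T)
  | ite_neg {r : ℕ} {P Q : Prog} {s s' : State} {T : ℕ} (hr : ¬ 0 < s.reg r)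
      (hQ : Runs bc W Q s s' T) : Runs bc W (.ite r P Q) s s' (1 + T)
  | loop_done {r : ℕ} {P : Prog} {s : State} (hr : ¬ 0 < s.reg r) :
      Runs bc W (.loop r P) s s 1
  | loop_step {r : ℕ} {P : Prog} {s₁ s₂ s₃ : State} {T₁ T₂ : ℕ} (hr : 0 < s₁.reg r)
      (hP : Runs bc W P s₁ s₂ T₁) (hQ : Runs bc W (.loop r P) s₂ s₃ T₂) :
      Runs bc W (.loop r P) s₁ s₃ (1 + T₁ + T₂)

/-- The start configuration for an input: it is stored in the memory from address `0` on, and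
everything else is zero. -/
def State.ofInput (x : List ℤ) : State where
  reg := fun _ => 0
  mem := fun j => x.getD j 0

end RAM

/-! ### Shuffle Membership -/

/-- The shuffle of a family of languages. The operands are made disjoint by tagging every letter
with the index of the operand it comes from; a word over the tagged alphabet belongs to the shuffle
if each of its projections is in the corresponding operand or empty; the tags are then erased. -/
def shuffle {α ι : Type*} [DecidableEq ι] (L : ι → Language α) : Language α :=
  {w | ∃ u : List (α × ι), u.map Prod.fst = w ∧
    ∀ i, (u.filter (fun x => x.2 = i)).map Prod.fst ∈ L i ∨
      (u.filter (fun x => x.2 = i)).map Prod.fst = []}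

/-- An instance of Shuffle Membership: a word `w` and `t` NFAs over an alphabet with `g` letters,
the `i`-th of which has `n i` states. -/
structure ShuffleInstance where
  g : ℕ
  w : List (Fin g)
  t : ℕ
  n : Fin t → ℕ
  B : (i : Fin t) → NFA (Fin g) (Fin (n i))

namespace ShuffleInstance

/-- The length of the word. -/
def k (I : ShuffleInstance) : ℕ := I.w.length

/-- The maximal number of states of the automata. -/
def b (I : ShuffleInstance) : ℕ := Finset.univ.sup I.n

/-- The question of the problem. -/
def IsYes (I : ShuffleInstance) : Prop := I.w ∈ shuffle (fun i => (I.B i).accepts)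

open Classical in
/-- The truth value of a proposition as a number. -/
noncomputable def bit (p : Prop) : ℤ := if p then 1 else 0

/-- An NFA as a list of numbers: the number of states, the characteristic vectors of the initial
and of the final states, and the table of the transition relation, whose entries for `(p, q, a)`
are listed in lexicographic order. -/
noncomputable def encodeNFA {g n : ℕ} (M : NFA (Fin g) (Fin n)) : List ℤ :=
  [(n : ℤ)]
    ++ (List.finRange n).map (fun p => bit (p ∈ M.start))
    ++ (List.finRange n).map (fun p => bit (p ∈ M.accept))
    ++ (List.finRange n).flatMap (fun p => (List.finRange n).flatMap (fun q =>
        (List.finRange g).map (fun a => bit (q ∈ M.step p a))))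

/-- The input of the machine: `k`, `t`, the number of letters, the word, and the automata. -/
noncomputable def encode (I : ShuffleInstance) : List ℤ :=
  [(I.k : ℤ), (I.t : ℤ), (I.g : ℤ)]
    ++ I.w.map (fun a => ((a : ℕ) : ℤ))
    ++ (List.finRange I.t).flatMap (fun i => encodeNFA (I.B i))

end ShuffleInstance

/-!
Shuffle Membership is solved by a dynamic program over sets of positions, coded as bit masks
`S < 2 ^ k`. Let `Covers i S` say that the positions in `S` can be distributed among the first `i`
automata so that each of them accepts its subword or gets no letter; `w` is in the shuffle if and
only if `Covers t (2 ^ k - 1)` (`mem_shuffle_iff_covers`). To get from `i` to `i + 1` in time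
`O(2 ^ k * k * b ^ 2)`, rather than by a convolution over all pairs of disjoint sets, the automaton
`i` decides for the positions `j = 0, 1, …` in turn whether it reads the `j`-th letter. Let
`Reaches i j S q` say that `S` can be distributed among the first `i` automata and the automaton
`i`, which gets only positions less than `j` and reaches the state `q`. Then (`reaches_succ`)
`Reaches i (j + 1) S q` holds if and only if `Reaches i j S q` does, or `j ∈ S` and
`Reaches i j (S \ {j}) p` for some `p` from which the `j`-th letter leads to `q`; the cases `j = 0`
and `j = k` are `reaches_zero` and `covers_succ`.

The recursion works in place: in step `j` only entries with `j ∈ S` are written, and only entries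
with `j ∉ S` are read. Every step is made of joins of tables of length `2 ^ k`, where one table is
or-ed into another one, possibly shifted by `2 ^ j` and restricted to the `S` with `j ∈ S`. The
`j`-th bit of `S` is tested by means of a counter modulo `2 ^ (j + 1)`, and addresses are computed
incrementally, so that the program uses no multiplication at all; the summand `k * bc k` of the
bound is only needed to be positive. Each automaton gets fresh memory for its tables, which is
initially zero, and all addresses stay polynomial in `2 ^ k` and `t + b + g + 1`, as the word length
requires (`addresses_lt`).

The programs are verified with weakest preconditions that also account for the running time (`wp`).
A subprogram leaves all registers above a certain index alone: `10` for `joinProg`, `15` for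
`rowProg`; this is the frame condition in its specification.
-/

/-! ### Total correctness with running time -/

namespace RAM

/-- `s.set d v` is `s` with `v` in register `d`, without an overflow check. -/
def State.set (s : State) (d : ℕ) (v : ℤ) : State := { s with reg := Function.update s.reg d v }

/-- `s.put z v` is `s` with `v` in the memory cell `z`. -/
def State.put (s : State) (z : ℕ) (v : ℤ) : State := { s with mem := Function.update s.mem z v }

@[simp] theorem State.reg_set (s : State) (d : ℕ) (v : ℤ) (r : ℕ) :
    (s.set d v).reg r = if r = d then v else s.reg r := by
  simp [State.set, Function.update_apply]

@[simp] theorem State.mem_set (s : State) (d : ℕ) (v : ℤ) : (s.set d v).mem = s.mem := rfl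

@[simp] theorem State.reg_put (s : State) (z : ℕ) (v : ℤ) : (s.put z v).reg = s.reg := rfl

@[simp] theorem State.mem_put (s : State) (z : ℕ) (v : ℤ) :
    (s.put z v).mem = Function.update s.mem z v := rfl

/-- Sequential composition of a list of programs. -/
def Prog.ofList : List Prog → Prog
  | [] => .skip
  | P :: l => .seq P (Prog.ofList l)

/-- The weakest precondition of `Q` under `P`, where `Q` speaks of the final state and of the
running time. -/
def wp (bc : ℕ → ℕ) (W : ℕ) (P : Prog) (s : State) (Q : State → ℕ → Prop) : Prop :=
  ∃ s' T, P.Runs bc W s s' T ∧ Q s' T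

variable {bc : ℕ → ℕ} {W : ℕ}

theorem wp.mono {P : Prog} {s : State} {Q Q' : State → ℕ → Prop} (h : wp bc W P s Q)
    (hQ : ∀ s' T, Q s' T → Q' s' T) : wp bc W P s Q' := by
  obtain ⟨s', T, h, hq⟩ := h
  exact ⟨s', T, h, hQ _ _ hq⟩

theorem wp_skip {s : State} {Q : State → ℕ → Prop} : wp bc W .skip s Q ↔ Q s 0 := by
  constructor
  · rintro ⟨s', T, h, hq⟩
    cases h
    exact hq
  · exact fun h => ⟨s, 0, .skip s, h⟩

theorem wp_ofList_nil {s : State} {Q : State → ℕ → Prop} :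
    wp bc W (.ofList []) s Q ↔ Q s 0 := wp_skip

theorem wp_ofList_cons {P : Prog} {l : List Prog} {s : State} {Q : State → ℕ → Prop}
    (h : wp bc W P s fun s₁ T₁ => wp bc W (.ofList l) s₁ fun s₂ T₂ => Q s₂ (T₁ + T₂)) :
    wp bc W (.ofList (P :: l)) s Q := by
  obtain ⟨s₁, T₁, h₁, s₂, T₂, h₂, hq⟩ := h
  exact ⟨s₂, _, .seq h₁ h₂, hq⟩

theorem wp_ite {r : ℕ} {P P' : Prog} {s : State} {Q : State → ℕ → Prop}
    (hP : 0 < s.reg r → wp bc W P s fun s' T => Q s' (1 + T))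
    (hP' : ¬ 0 < s.reg r → wp bc W P' s fun s' T => Q s' (1 + T)) :
    wp bc W (.ite r P P') s Q := by
  by_cases hr : 0 < s.reg r
  · obtain ⟨s', T, h, hq⟩ := hP hr
    exact ⟨s', _, .ite_pos hr h, hq⟩
  · obtain ⟨s', T, h, hq⟩ := hP' hr
    exact ⟨s', _, .ite_neg hr h, hq⟩

theorem wp_ofList_instr {i : Instr} {l : List Prog} {s : State} {Q : State → ℕ → Prop} :
    wp bc W (.ofList (.instr i :: l)) s Q ↔
      ∃ s', i.exec W s = some s' ∧ wp bc W (.ofList l) s' fun s₂ T => Q s₂ (i.cost bc s + T) := by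
  constructor
  · rintro ⟨s', T, h, hq⟩
    cases h with
    | seq h h' =>
      cases h with
      | instr h => exact ⟨_, h, _, _, h', hq⟩
  · rintro ⟨s₁, h, s₂, T, h', hq⟩
    exact ⟨s₂, _, .seq (.instr h) h', hq⟩

theorem exists_setReg_eq_some {s : State} {d : ℕ} {v : ℤ} {R : State → Prop} :
    (∃ s', s.setReg W d v = some s' ∧ R s') ↔ v.natAbs < 2 ^ W ∧ R (s.set d v) := by
  by_cases h : v.natAbs < 2 ^ W <;> simp [State.setReg, State.set, h]

section Instr

variable {l : List Prog} {s : State} {Q : State → ℕ → Prop}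

theorem wp_const {d : ℕ} {z : ℤ} :
    wp bc W (.ofList (.instr (.const d z) :: l)) s Q ↔
      z.natAbs < 2 ^ W ∧ wp bc W (.ofList l) (s.set d z) fun s₂ T => Q s₂ (1 + T) := by
  rw [wp_ofList_instr]
  exact exists_setReg_eq_some

theorem wp_move {d a : ℕ} :
    wp bc W (.ofList (.instr (.move d a) :: l)) s Q ↔ (s.reg a).natAbs < 2 ^ W ∧
      wp bc W (.ofList l) (s.set d (s.reg a)) fun s₂ T => Q s₂ (1 + T) := by
  rw [wp_ofList_instr]
  exact exists_setReg_eq_some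

theorem wp_add {d a b : ℕ} :
    wp bc W (.ofList (.instr (.add d a b) :: l)) s Q ↔ (s.reg a + s.reg b).natAbs < 2 ^ W ∧
      wp bc W (.ofList l) (s.set d (s.reg a + s.reg b)) fun s₂ T => Q s₂ (1 + T) := by
  rw [wp_ofList_instr]
  exact exists_setReg_eq_some

theorem wp_sub {d a b : ℕ} :
    wp bc W (.ofList (.instr (.sub d a b) :: l)) s Q ↔ (s.reg a - s.reg b).natAbs < 2 ^ W ∧
      wp bc W (.ofList l) (s.set d (s.reg a - s.reg b)) fun s₂ T => Q s₂ (1 + T) := by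
  rw [wp_ofList_instr]
  exact exists_setReg_eq_some

theorem wp_load {d a : ℕ} :
    wp bc W (.ofList (.instr (.load d a) :: l)) s Q ↔
      0 ≤ s.reg a ∧ (s.mem (s.reg a).toNat).natAbs < 2 ^ W ∧
      wp bc W (.ofList l) (s.set d (s.mem (s.reg a).toNat)) fun s₂ T => Q s₂ (1 + T) := by
  rw [wp_ofList_instr]
  by_cases h : 0 ≤ s.reg a
  · simp only [Instr.exec, h, if_true, true_and]
    exact exists_setReg_eq_some
  · simp [Instr.exec, h]

theorem wp_store {a b : ℕ} :
    wp bc W (.ofList (.instr (.store a b) :: l)) s Q ↔ 0 ≤ s.reg a ∧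
      wp bc W (.ofList l) (s.put (s.reg a).toNat (s.reg b)) fun s₂ T => Q s₂ (1 + T) := by
  rw [wp_ofList_instr]
  by_cases h : 0 ≤ s.reg a <;> simp [Instr.exec, State.put, Instr.cost, h]

end Instr

/-- The rule for loops in which register `r` counts down from `n` to `0`. -/
theorem wp_loop {r : ℕ} {P : Prog} {s : State} (n : ℕ) (Inv : ℕ → State → Prop) (τ : ℕ)
    (h0 : Inv 0 s) (hr : ∀ i s, i ≤ n → Inv i s → s.reg r = (n : ℤ) - i)
    (hstep : ∀ i s, i < n → Inv i s → wp bc W P s fun s' T => Inv (i + 1) s' ∧ T ≤ τ) :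
    wp bc W (.loop r P) s fun s' T => Inv n s' ∧ T ≤ 1 + n * (τ + 1) := by
  suffices H : ∀ j i s, i + j = n → Inv i s →
      wp bc W (.loop r P) s fun s' T => Inv n s' ∧ T ≤ 1 + j * (τ + 1) from
    H n 0 s (Nat.zero_add n) h0
  intro j
  induction j with
  | zero =>
    intro i s hi hI
    obtain rfl : i = n := by omega
    have := hr i s le_rfl hI
    exact ⟨s, 1, .loop_done (by omega), hI, by omega⟩
  | succ j ih =>
    intro i s hi hI
    have := hr i s (by omega) hI
    obtain ⟨s₁, T₁, h₁, hI₁, hT₁⟩ := hstep i s (by omega) hI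
    obtain ⟨s₂, T₂, h₂, hI₂, hT₂⟩ := ih (i + 1) s₁ (by omega) hI₁
    refine ⟨s₂, _, .loop_step (by omega) h₁ h₂, hI₂, ?_⟩
    rw [Nat.succ_mul]
    omega

end RAM

/-! ### Row operations on bit tables -/

namespace RAM

variable {bc : ℕ → ℕ} {W : ℕ}

open Classical in
/-- The memory `μ` after the table at `Y` has been joined with the one at `X`: the entry `S < n` at
`Y` becomes `1` if the entry `S - m` at `X` is positive, for all `S` with `m ≤ S % (2 * m)`.
For `m = 2 ^ j` these are the `S` whose `j`-th bit is set; for `m = 0` they are all `S`. -/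
noncomputable def joinMem (μ : ℕ → ℤ) (X Y m n : ℕ) (z : ℕ) : ℤ :=
  if ∃ S < n, m ≤ S % (2 * m) ∧ 0 < μ (X + S - m) ∧ z = Y + S then 1 else μ z

theorem joinMem_zero (μ : ℕ → ℤ) (X Y m : ℕ) : joinMem μ X Y m 0 = μ := by
  funext z
  simp [joinMem]

theorem joinMem_succ (μ : ℕ → ℤ) (X Y m n : ℕ) :
    joinMem μ X Y m (n + 1) = if m ≤ n % (2 * m) ∧ 0 < μ (X + n - m) then
      Function.update (joinMem μ X Y m n) (Y + n) 1 else joinMem μ X Y m n := by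
  funext z
  split_ifs with h
  · rw [Function.update_apply]
    split_ifs with hz
    · exact if_pos ⟨n, by omega, h.1, h.2, hz⟩
    · refine if_congr ⟨?_, ?_⟩ rfl rfl
      · rintro ⟨S, hS, h1, h2, h3⟩
        obtain hS | rfl : S < n ∨ S = n := by omega
        · exact ⟨S, hS, h1, h2, h3⟩
        · exact absurd h3 hz
      · rintro ⟨S, hS, h⟩
        exact ⟨S, by omega, h⟩
  · refine if_congr ⟨?_, ?_⟩ rfl rfl
    · rintro ⟨S, hS, h1, h2, h3⟩
      obtain hS | rfl : S < n ∨ S = n := by omega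
      · exact ⟨S, hS, h1, h2, h3⟩
      · exact absurd ⟨h1, h2⟩ h
    · rintro ⟨S, hS, h⟩
      exact ⟨S, by omega, h⟩

/-- Join two tables. Register `10` holds `X`, `11` holds `Y`, `20` holds `m`, and `61` the length of
the tables. Register `3` runs through the residues of `S` modulo `2 * m`; it stays `0` if `m = 0`,
so that the test in the loop always succeeds. -/
def joinProg : Prog := .ofList [
  .instr (.sub 1 10 20),
  .instr (.move 2 11),
  .instr (.move 5 61),
  .instr (.const 3 0),
  .loop 5 (.ofList [
    .instr (.sub 4 3 20),
    .instr (.add 4 4 60),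
    .ite 4
      (.ofList [.instr (.load 4 1), .ite 4 (.ofList [.instr (.store 2 60)]) .skip])
      .skip,
    .instr (.add 1 1 60),
    .instr (.add 2 2 60),
    .instr (.sub 5 5 60),
    .instr (.add 3 3 60),
    .instr (.add 4 20 20),
    .instr (.sub 4 4 3),
    .ite 4 .skip (.ofList [.instr (.const 3 0)])])]

/-- All memory cells hold natural numbers that fit into a word. -/
def State.MemFits (W : ℕ) (s : State) : Prop := ∀ z, 0 ≤ s.mem z ∧ (s.mem z).natAbs < 2 ^ W

/-- The correctness of `joinProg`, if no cell that is read can be one that is written. -/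
theorem wp_joinProg {s : State} {X Y m N : ℕ} (h10 : s.reg 10 = X) (h11 : s.reg 11 = Y)
    (h20 : s.reg 20 = m) (h60 : s.reg 60 = 1) (h61 : s.reg 61 = N)
    (hmem : s.MemFits W) (hX : X + N < 2 ^ W) (hY : Y + N < 2 ^ W) (hm : 2 * m ≤ N)
    (hsep : ∀ S S', S < N → S' < N → m ≤ S % (2 * m) → m ≤ S' % (2 * m) → X + S - m ≠ Y + S') :
    wp bc W joinProg s fun s' T => (∀ r, 10 ≤ r → s'.reg r = s.reg r) ∧
      s'.mem = joinMem s.mem X Y m N ∧ T ≤ 20 * N + 5 := by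
  simp only [joinProg, wp_sub, wp_move, wp_const]
  simp [h10, h11, h20, h61]
  refine ⟨by omega, by omega, by omega, ?_⟩
  refine wp_ofList_cons ((wp_loop N (fun i s' => (∀ r, 10 ≤ r → s'.reg r = s.reg r) ∧
      s'.mem = joinMem s.mem X Y m i ∧ s'.reg 1 = X + i - m ∧ s'.reg 2 = Y + i ∧
      s'.reg 5 = N - i ∧ s'.reg 3 = (i % (max (2 * m) 1) : ℕ)) 19 ?_ ?_ ?_).mono ?_)
  · refine ⟨fun r hr => ?_, ?_⟩
    · simp
      split_ifs <;> omega
    · simp [joinMem_zero]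
  · rintro i s' - ⟨-, -, -, -, h, -⟩
    exact h
  · rintro i s' hi ⟨hf, hμ, h1, h2, h5, h3⟩
    have g20 : s'.reg 20 = m := by rw [hf _ (by norm_num), h20]
    have g60 : s'.reg 60 = 1 := by rw [hf _ (by norm_num), h60]
    have hfit : s'.MemFits W := by
      intro z
      rw [hμ, joinMem]
      split_ifs
      · exact ⟨by norm_num, by rw [Int.natAbs_one]; omega⟩
      · exact hmem z
    have hmod : (m ≤ i % (2 * m)) ↔ m ≤ i % (max (2 * m) 1) := by
      rcases Nat.eq_zero_or_pos m with rfl | h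
      · simp
      · rw [max_eq_left (by omega)]
    have hlt : i % max (2 * m) 1 < max (2 * m) 1 := Nat.mod_lt _ (by omega)
    have hsucc : (i + 1) % max (2 * m) 1 =
        if i % max (2 * m) 1 + 1 < 2 * m then i % max (2 * m) 1 + 1 else 0 := by
      rw [Nat.add_mod_eq_ite]
      rcases Nat.eq_zero_or_pos m with rfl | h
      · simp [Nat.mod_one]
      · rw [max_eq_left (by omega), Nat.mod_eq_of_lt (by omega : 1 < 2 * m)] at *
        split_ifs <;> omega
    have hsucc' : ((i : ℤ) + 1) % max (2 * (m : ℤ)) 1 =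
        if i % max (2 * m) 1 + 1 < 2 * m then (i % max (2 * m) 1 : ℕ) + 1 else 0 := by
      exact_mod_cast congrArg (Nat.cast (R := ℤ)) hsucc
    have hle : i % max (2 * m) 1 ≤ i := Nat.mod_le _ _
    set c := i % max (2 * m) 1 with hc
    simp only [wp_sub, wp_add]
    simp [h3, g20, g60]
    refine ⟨by omega, by omega, ?_⟩
    -- The state after the conditional store, and what remains to be done from there.
    have rest : ∀ (s₁ : State) (T₁ : ℕ), T₁ ≤ 4 → (∀ r, r ≠ 4 → s₁.reg r = s'.reg r) →
        s₁.mem = joinMem s.mem X Y m (i + 1) → wp bc W (.ofList [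
          .instr (.add 1 1 60), .instr (.add 2 2 60), .instr (.sub 5 5 60), .instr (.add 3 3 60),
          .instr (.add 4 20 20), .instr (.sub 4 4 3),
          .ite 4 .skip (.ofList [.instr (.const 3 0)])]) s₁ fun s' T =>
        ((∀ r, 10 ≤ r → s'.reg r = s.reg r) ∧
          s'.mem = joinMem s.mem X Y m (i + 1) ∧ s'.reg 1 = X + ((i : ℤ) + 1) - m ∧
          s'.reg 2 = Y + ((i : ℤ) + 1) ∧ s'.reg 5 = N - ((i : ℤ) + 1) ∧
          s'.reg 3 = ((i : ℤ) + 1) % (max (2 * (m : ℤ)) 1)) ∧ 1 + (1 + (T₁ + T)) ≤ 19 := by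
      intro s₁ T₁ hT₁ hr hm₁
      simp only [wp_sub, wp_add]
      simp [hr, h1, h2, h3, h5, g20, g60]
      refine ⟨by omega, by omega, by omega, by omega, by omega, by omega, ?_⟩
      refine wp_ofList_cons (wp_ite (fun h => wp_skip.2 ?_) fun h => ?_)
      · simp at h
        refine wp_ofList_nil.2 ⟨⟨fun r hr' => ?_, hm₁, ?_, ?_, ?_, ?_⟩, by omega⟩
        · simp only [State.reg_set]
          split_ifs <;> first | omega | rw [hr _ (by omega), hf _ hr']
        · simp; omega
        · simp; omega
        · simp; omega
        · rw [hsucc', if_pos (by omega)]; simp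
      · simp at h
        refine wp_const.2 ⟨by simp, wp_ofList_nil.2 (wp_ofList_nil.2
          ⟨⟨fun r hr' => ?_, hm₁, ?_, ?_, ?_, ?_⟩, by omega⟩)⟩
        · simp only [State.reg_set]
          split_ifs <;> first | omega | rw [hr _ (by omega), hf _ hr']
        · simp; omega
        · simp; omega
        · simp; omega
        · rw [hsucc', if_neg (by omega)]; simp
    refine wp_ofList_cons (wp_ite (fun h => ?_) fun h => ?_)
    · simp at h
      have hci : m ≤ c := by omega
      have hmi := hmod.2 hci
      have haddr : (X + i - m : ℤ).toNat = X + i - m := by omega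
      have hval : s'.mem (X + i - m) = s.mem (X + i - m) := by
        rw [hμ, joinMem, if_neg]
        rintro ⟨S, hS, h1, -, h2⟩
        exact hsep i S hi (by omega) hmi h1 h2
      have hv := hfit (X + i - m)
      simp only [wp_load]
      simp [h1, haddr]
      refine ⟨by omega, hv.2, wp_ofList_cons (wp_ite (fun h => ?_) fun h => wp_skip.2 ?_)⟩
      · simp [hval] at h
        simp only [wp_store]
        simp [h2, g60]
        refine ⟨by omega, wp_ofList_nil.2 (wp_ofList_nil.2 (rest _ _ ?_ ?_ ?_))⟩
        · omega
        · intro r hr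
          simp [hr]
        · rw [joinMem_succ, if_pos ⟨hmi, h⟩]
          simp [hμ, show ((Y : ℤ) + i).toNat = Y + i by omega]
      · simp [hval] at h
        refine wp_ofList_nil.2 (rest _ _ ?_ ?_ ?_)
        · omega
        · intro r hr
          simp [hr]
        · rw [joinMem_succ, if_neg (by omega)]
          simp [hμ]
    · simp at h
      refine wp_skip.2 (rest _ _ ?_ ?_ ?_)
      · omega
      · intro r hr
        simp [hr]
      · rw [joinMem_succ, if_neg (by omega)]
        simp [hμ]
  · rintro s' T ⟨⟨hf, hμ, -⟩, hT⟩
    exact wp_ofList_nil.2 ⟨hf, hμ, by omega⟩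

open Classical in
/-- The memory `μ` after a row of joins: for all `q < n` for which the cell `A + q * dA` is
positive, the table at `Y + q * dY` is joined with the one at `X + q * dX`, in the sense of
`joinMem`. All cells are read in the memory `μ` before the row operation. -/
noncomputable def rowMem (μ : ℕ → ℤ) (A dA X dX Y dY m N n : ℕ) (z : ℕ) : ℤ :=
  if ∃ q < n, ∃ S < N, m ≤ S % (2 * m) ∧ 0 < μ (A + q * dA) ∧ 0 < μ (X + q * dX + S - m) ∧
    z = Y + q * dY + S then 1 else μ z

theorem rowMem_zero (μ : ℕ → ℤ) (A dA X dX Y dY m N : ℕ) :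
    rowMem μ A dA X dX Y dY m N 0 = μ := by
  funext z
  simp [rowMem]

/-- Off the set of written cells, a row operation does not change the memory. -/
theorem rowMem_of_not {μ : ℕ → ℤ} {A dA X dX Y dY m N n : ℕ} {V : ℕ → Prop}
    (hV : ∀ q < n, ∀ S < N, m ≤ S % (2 * m) → V (Y + q * dY + S)) {z : ℕ} (hz : ¬ V z) :
    rowMem μ A dA X dX Y dY m N n z = μ z := by
  refine if_neg ?_
  rintro ⟨q, hq, S, hS, hm, -, -, rfl⟩
  exact hz (hV q hq S hS hm)

theorem rowMem_succ {μ : ℕ → ℤ} {A dA X dX Y dY m N n : ℕ} {V : ℕ → Prop}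
    (hV : ∀ q < n, ∀ S < N, m ≤ S % (2 * m) → V (Y + q * dY + S))
    (hX : ∀ S < N, m ≤ S % (2 * m) → ¬ V (X + n * dX + S - m)) :
    rowMem μ A dA X dX Y dY m N (n + 1) = if 0 < μ (A + n * dA) then
      joinMem (rowMem μ A dA X dX Y dY m N n) (X + n * dX) (Y + n * dY) m N
      else rowMem μ A dA X dX Y dY m N n := by
  funext z
  split_ifs with h
  · rw [joinMem]
    split_ifs with hz
    · obtain ⟨S, hS, h1, h2, h3⟩ := hz
      rw [rowMem_of_not hV (hX S hS h1)] at h2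
      exact if_pos ⟨n, by omega, S, hS, h1, h, h2, h3⟩
    · refine if_congr ⟨?_, ?_⟩ rfl rfl
      · rintro ⟨q, hq, S, hS, h1, h2, h3, h4⟩
        obtain hq | rfl : q < n ∨ q = n := by omega
        · exact ⟨q, hq, S, hS, h1, h2, h3, h4⟩
        · refine absurd ⟨S, hS, h1, ?_, h4⟩ hz
          rwa [rowMem_of_not hV (hX S hS h1)]
      · rintro ⟨q, hq, h⟩
        exact ⟨q, by omega, h⟩
  · refine if_congr ⟨?_, ?_⟩ rfl rfl
    · rintro ⟨q, hq, S, hS, h1, h2, h3, h4⟩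
      obtain hq | rfl : q < n ∨ q = n := by omega
      · exact ⟨q, hq, S, hS, h1, h2, h3, h4⟩
      · exact absurd h2 h
    · rintro ⟨q, hq, h⟩
      exact ⟨q, by omega, h⟩

/-- A row of joins. Registers `10`, `11`, `12` hold `X`, `Y`, `A` and are advanced by the contents
of the registers `24`, `25`, `23`; register `22` holds the number of joins. -/
def rowProg : Prog := .ofList [
  .instr (.move 13 22),
  .loop 13 (.ofList [
    .instr (.load 14 12),
    .ite 14 joinProg .skip,
    .instr (.add 10 10 24),
    .instr (.add 11 11 25),
    .instr (.add 12 12 23),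
    .instr (.sub 13 13 60)])]

theorem State.MemFits.of_eq_one_or {s s' : State} (hs : s.MemFits W) (hW : 1 < 2 ^ W)
    (h : ∀ z, s'.mem z = 1 ∨ s'.mem z = s.mem z) : s'.MemFits W := by
  intro z
  rcases h z with h | h <;> rw [h]
  · exact ⟨zero_le_one, hW⟩
  · exact hs z

theorem rowMem_eq_one_or (μ : ℕ → ℤ) (A dA X dX Y dY m N n z : ℕ) :
    rowMem μ A dA X dX Y dY m N n z = 1 ∨ rowMem μ A dA X dX Y dY m N n z = μ z := by
  rw [rowMem]
  split_ifs <;> simp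

/-- The correctness of `rowProg`. The set `V` separates the cells that may be written from the cells
that are read. -/
theorem wp_rowProg {s : State} {A dA X dX Y dY m N n : ℕ}
    (h10 : s.reg 10 = X) (h11 : s.reg 11 = Y) (h12 : s.reg 12 = A)
    (h20 : s.reg 20 = m) (h22 : s.reg 22 = n) (h23 : s.reg 23 = dA) (h24 : s.reg 24 = dX)
    (h25 : s.reg 25 = dY) (h60 : s.reg 60 = 1) (h61 : s.reg 61 = N)
    (hmem : s.MemFits W) (hA : A + n * dA < 2 ^ W) (hX : X + n * dX + N < 2 ^ W)
    (hY : Y + n * dY + N < 2 ^ W) (hn : n < 2 ^ W) (hm : 2 * m ≤ N) (hN : 0 < N) (V : ℕ → Prop)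
    (hVY : ∀ q < n, ∀ S < N, m ≤ S % (2 * m) → V (Y + q * dY + S))
    (hVX : ∀ q < n, ∀ S < N, m ≤ S % (2 * m) → ¬ V (X + q * dX + S - m))
    (hVA : ∀ q < n, ¬ V (A + q * dA)) :
    wp bc W rowProg s fun s' T => (∀ r, 15 ≤ r → s'.reg r = s.reg r) ∧
      s'.mem = rowMem s.mem A dA X dX Y dY m N n ∧ s'.reg 10 = (X + n * dX : ℕ) ∧
      s'.reg 11 = (Y + n * dY : ℕ) ∧ s'.reg 12 = (A + n * dA : ℕ) ∧
      T ≤ n * (20 * N + 12) + 2 := by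
  simp only [rowProg, wp_move]
  refine ⟨by rw [h22]; omega, ?_⟩
  refine wp_ofList_cons ((wp_loop n (fun i s' => (∀ r, 15 ≤ r → s'.reg r = s.reg r) ∧
      s'.mem = rowMem s.mem A dA X dX Y dY m N i ∧ s'.reg 10 = (X + i * dX : ℕ) ∧
      s'.reg 11 = (Y + i * dY : ℕ) ∧ s'.reg 12 = (A + i * dA : ℕ) ∧
      s'.reg 13 = n - i) (20 * N + 11) ?_ ?_ ?_).mono ?_)
  · refine ⟨fun r hr => ?_, ?_⟩
    · rw [State.reg_set, if_neg (by omega)]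
    · simp [rowMem_zero, h10, h11, h12, h22]
  · rintro i s' - ⟨-, -, -, -, -, h⟩
    exact h
  · rintro i s' hi ⟨hf, hμ, g10, g11, g12, g13⟩
    have hiA := Nat.mul_le_mul_right dA (Nat.succ_le_of_lt hi)
    have hiX := Nat.mul_le_mul_right dX (Nat.succ_le_of_lt hi)
    have hiY := Nat.mul_le_mul_right dY (Nat.succ_le_of_lt hi)
    have g20 : s'.reg 20 = m := by rw [hf _ (by norm_num), h20]
    have g23 : s'.reg 23 = dA := by rw [hf _ (by norm_num), h23]
    have g24 : s'.reg 24 = dX := by rw [hf _ (by norm_num), h24]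
    have g25 : s'.reg 25 = dY := by rw [hf _ (by norm_num), h25]
    have g60 : s'.reg 60 = 1 := by rw [hf _ (by norm_num), h60]
    have g61 : s'.reg 61 = N := by rw [hf _ (by norm_num), h61]
    have hfit : s'.MemFits W := hmem.of_eq_one_or (by omega) fun z => by
      rw [hμ]
      exact rowMem_eq_one_or _ _ _ _ _ _ _ _ _ _ _
    have hVY' : ∀ q < i, ∀ S < N, m ≤ S % (2 * m) → V (Y + q * dY + S) :=
      fun q hq => hVY q (by omega)
    have hsucc := rowMem_succ (μ := s.mem) (A := A) (dA := dA) hVY' (hVX i hi)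
    have hval : s'.mem (A + i * dA) = s.mem (A + i * dA) := by
      rw [hμ, rowMem_of_not hVY' (hVA i hi)]
    rw [Nat.succ_mul] at hiA hiX hiY
    generalize hP : (fun (s' : State) (T : ℕ) => ((∀ r, 15 ≤ r → s'.reg r = s.reg r) ∧
      s'.mem = rowMem s.mem A dA X dX Y dY m N (i + 1) ∧ s'.reg 10 = (X + (i + 1) * dX : ℕ) ∧
      s'.reg 11 = (Y + (i + 1) * dY : ℕ) ∧ s'.reg 12 = (A + (i + 1) * dA : ℕ) ∧
      s'.reg 13 = n - (i + 1 : ℕ)) ∧ T ≤ 20 * N + 11) = P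
    have rest : ∀ (s₁ : State) (T₁ : ℕ), T₁ ≤ 20 * N + 6 →
        (∀ r, 10 ≤ r → r ≠ 14 → s₁.reg r = s'.reg r) →
        s₁.mem = rowMem s.mem A dA X dX Y dY m N (i + 1) → wp bc W (.ofList [
          .instr (.add 10 10 24), .instr (.add 11 11 25), .instr (.add 12 12 23),
          .instr (.sub 13 13 60)]) s₁ fun s' T => P s' (1 + (T₁ + T)) := by
      intro s₁ T₁ hT₁ hr hm₁
      simp only [wp_sub, wp_add, wp_ofList_nil]
      simp [hr, g10, g11, g12, g13, g23, g24, g25, g60, ← hP]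
      refine ⟨by omega, by omega, by omega, by omega,
        ⟨fun r hr' => ?_, hm₁, ?_, ?_, ?_, by omega⟩, by omega⟩
      · rw [if_neg (by omega), if_neg (by omega), if_neg (by omega), if_neg (by omega),
          hr _ (by omega) (by omega), hf _ hr']
      all_goals ring
    have hv := hfit (A + i * dA)
    simp only [wp_load, g12, Int.toNat_natCast]
    refine ⟨by omega, hv.2, wp_ofList_cons (wp_ite (fun h => ?_) fun h => wp_skip.2 ?_)⟩
    · simp [hval] at h
      refine (wp_joinProg (s := s'.set 14 _) (X := X + i * dX) (Y := Y + i * dY)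
        (m := m) (N := N) (by simp [g10]) (by simp [g11]) (by simp [g20]) (by simp [g60])
        (by simp [g61]) hfit (by omega) (by omega) hm ?_).mono ?_
      · intro S S' hS hS' h1 h2 h3
        exact hVX i hi S hS h1 (h3 ▸ hVY i hi S' hS' h2)
      · rintro s₁ T₁ ⟨hf₁, hμ₁, hT₁⟩
        refine rest _ _ (by omega) ?_ ?_
        · intro r hr hr'
          rw [hf₁ r hr, State.reg_set, if_neg hr']
        · rw [hμ₁, hsucc, if_pos h, State.mem_set, hμ]
    · simp [hval] at h
      refine rest _ _ (by omega) ?_ ?_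
      · intro r hr hr'
        rw [State.reg_set, if_neg hr']
      · rw [hsucc, if_neg (by omega), State.mem_set, hμ]
  · rintro s' T ⟨⟨hf, hμ, g10, g11, g12, -⟩, hT⟩
    replace hT : T ≤ 1 + n * (20 * N + 12) := hT
    exact wp_ofList_nil.2 ⟨hf, hμ, g10, g11, g12, by omega⟩

end RAM

/-! ### Covering sets of positions by the automata -/

section Covering

variable {α : Type*}

open Classical in
/-- The subword of `w` formed by the letters at the positions `l < j` with `P l`. -/
noncomputable def subword (w : List α) (P : ℕ → Prop) : ℕ → List α
  | 0 => []
  | j + 1 => if P j then subword w P j ++ w[j]?.toList else subword w P j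

theorem subword_congr {w w' : List α} {P P' : ℕ → Prop} {j : ℕ} (hw : ∀ l < j, w[l]? = w'[l]?)
    (hP : ∀ l < j, P l ↔ P' l) : subword w P j = subword w' P' j := by
  induction j with
  | zero => rfl
  | succ j ih =>
    rw [subword, subword, hw j (by omega),
      ih (fun l hl => hw l (by omega)) fun l hl => hP l (by omega)]
    by_cases h : P' j
    · rw [if_pos h, if_pos ((hP j (by omega)).2 h)]
    · rw [if_neg h, if_neg fun h' => h ((hP j (by omega)).1 h')]

theorem subword_eq_nil_iff {w : List α} {P : ℕ → Prop} {j : ℕ} (hj : j ≤ w.length) :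
    subword w P j = [] ↔ ∀ l < j, ¬ P l := by
  induction j with
  | zero => simp [subword]
  | succ j ih =>
    rw [subword, List.getElem?_eq_getElem (by omega)]
    split_ifs with h
    · simp only [Option.toList_some, List.append_eq_nil_iff, List.cons_ne_nil, and_false,
        false_iff, not_forall]
      exact ⟨j, by omega, by simpa using h⟩
    · rw [ih (by omega)]
      refine ⟨fun H l hl => ?_, fun H l hl => H l (by omega)⟩
      obtain hl | rfl : l < j ∨ l = j := by omega
      · exact H l hl
      · exact h

theorem filter_map_eq_subword {ι : Type*} [DecidableEq ι] (u : List (α × ι)) (i : ι) :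
    (u.filter (fun x => x.2 = i)).map Prod.fst =
      subword (u.map Prod.fst) (fun l => u[l]?.map Prod.snd = some i) u.length := by
  induction u using List.reverseRecOn with
  | nil => rfl
  | append_singleton u x ih =>
    have h : subword (u.map Prod.fst) (fun l => u[l]?.map Prod.snd = some i) u.length =
        subword ((u ++ [x]).map Prod.fst) (fun l => (u ++ [x])[l]?.map Prod.snd = some i)
          u.length := by
      refine subword_congr (fun l hl => ?_) fun l hl => ?_
      · rw [List.map_append, List.getElem?_append_left (by simpa using hl)]
      · rw [List.getElem?_append_left hl]
    rw [List.filter_append, List.map_append, ih, h]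
    simp only [List.length_append, List.length_singleton, subword]
    by_cases hx : x.2 = i <;> simp [hx]

/-- The positions in the set coded by `S` can be distributed among the first `i` languages, so that
the subword given to each of them is in the language or empty. The function `c` maps a position to
the index of its language; it is at least `i` outside of `S`. -/
def Covers {t : ℕ} (L : Fin t → Language α) (w : List α) (i S : ℕ) : Prop :=
  ∃ c : ℕ → ℕ, (∀ l < w.length, S.testBit l ↔ c l < i) ∧ ∀ i' : Fin t, (i' : ℕ) < i →
    subword w (fun l => c l = i') w.length ∈ L i' ∨ subword w (fun l => c l = i') w.length = []

/-- The positions in the set coded by `S` can be distributed among the first `i` languages, as in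
`Covers`, and the automaton `M`, whose positions are less than `j`, so that `M` can be in the state
`q` after reading the subword given to it. -/
def Reaches {t : ℕ} (L : Fin t → Language α) (w : List α) (i : ℕ) {σ : Type*} (M : NFA α σ)
    (j S : ℕ) (q : σ) : Prop :=
  ∃ c : ℕ → ℕ, (∀ l < w.length, c l = i → l < j) ∧ (∀ l < w.length, S.testBit l ↔ c l ≤ i) ∧
    (∀ i' : Fin t, (i' : ℕ) < i →
      subword w (fun l => c l = i') w.length ∈ L i' ∨
        subword w (fun l => c l = i') w.length = []) ∧
    q ∈ M.eval (subword w (fun l => c l = i) j)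

variable {t : ℕ} {L : Fin t → Language α} {w : List α} {i S : ℕ}

theorem covers_zero (hS : S < 2 ^ w.length) : Covers L w 0 S ↔ S = 0 := by
  constructor
  · rintro ⟨c, hc, -⟩
    refine Nat.eq_of_testBit_eq fun l => ?_
    rw [Nat.zero_testBit]
    by_cases hl : l < w.length
    · simpa using hc l hl
    · exact Nat.testBit_eq_false_of_lt (hS.trans_le (Nat.pow_le_pow_right (by norm_num) (by omega)))
  · rintro rfl
    exact ⟨fun _ => 0, by simp, by simp⟩

/-- The positions outside of `S` can be assumed to avoid the index `i`. -/
theorem Covers.exists_ne (h : Covers L w i S) :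
    ∃ c : ℕ → ℕ, (∀ l, c l ≠ i) ∧ (∀ l < w.length, S.testBit l ↔ c l < i) ∧
      ∀ i' : Fin t, (i' : ℕ) < i → subword w (fun l => c l = i') w.length ∈ L i' ∨
        subword w (fun l => c l = i') w.length = [] := by
  obtain ⟨c, hc, h⟩ := h
  refine ⟨fun l => if c l < i then c l else i + 1, fun l => ?_, fun l hl => ?_, fun i' hi' => ?_⟩
  · dsimp only
    split_ifs <;> omega
  · rw [hc l hl]
    dsimp only
    split_ifs <;> omega
  · rw [subword_congr (P' := fun l => c l = i') (fun _ _ => rfl) fun l _ => ?_]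
    · exact h i' hi'
    · dsimp only
      split_ifs <;> omega

variable {σ : Type*} {M : NFA α σ} {j : ℕ} {q : σ}

theorem reaches_zero : Reaches L w i M 0 S q ↔ Covers L w i S ∧ q ∈ M.start := by
  constructor
  · rintro ⟨c, h1, h2, h3, h4⟩
    refine ⟨⟨c, fun l hl => ?_, h3⟩, h4⟩
    have := h1 l hl
    rw [h2 l hl]
    omega
  · rintro ⟨h, hq⟩
    obtain ⟨c, h1, h2, h3⟩ := h.exists_ne
    refine ⟨c, fun l _ h => absurd h (h1 l), fun l hl => ?_, h3, hq⟩
    have := h1 l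
    rw [h2 l hl]
    omega

theorem two_pow_le_of_testBit {S j : ℕ} (h : S.testBit j) : 2 ^ j ≤ S := by
  by_contra hS
  rw [Nat.testBit_eq_false_of_lt (by omega)] at h
  exact absurd h (by simp)

/-- Subtracting `2 ^ j` removes `j` from the set coded by `S`. -/
theorem testBit_sub_two_pow {S j : ℕ} (h : S.testBit j) (l : ℕ) :
    (S - 2 ^ j).testBit l ↔ l ≠ j ∧ S.testBit l := by
  induction j generalizing S l with
  | zero =>
    rw [Nat.testBit_zero, decide_eq_true_iff] at h
    cases l with
    | zero => simp only [Nat.testBit_zero, pow_zero, decide_eq_true_iff]; omega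
    | succ l =>
      rw [Nat.testBit_succ, Nat.testBit_succ, show (S - 2 ^ 0) / 2 = S / 2 by omega]
      simp
  | succ j ih =>
    rw [Nat.testBit_succ] at h
    have hle := two_pow_le_of_testBit h
    cases l with
    | zero =>
      simp only [Nat.testBit_zero, pow_succ, decide_eq_true_iff]
      omega
    | succ l =>
      rw [Nat.testBit_succ, Nat.testBit_succ, show (S - 2 ^ (j + 1)) / 2 = S / 2 - 2 ^ j by omega,
        ih h]
      simp

/-- Either `M` does not read the letter at position `j`, or it does so in the last step. -/
theorem reaches_succ (hj : j < w.length) : Reaches L w i M (j + 1) S q ↔ Reaches L w i M j S q ∨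
    S.testBit j ∧ ∃ p, Reaches L w i M j (S - 2 ^ j) p ∧ q ∈ M.step p w[j] := by
  constructor
  · rintro ⟨c, h1, h2, h3, h4⟩
    by_cases hc : c j = i
    · have hb : S.testBit j := (h2 j hj).2 hc.le
      rw [subword, if_pos hc, List.getElem?_eq_getElem hj, Option.toList_some,
        NFA.eval_append_singleton, NFA.mem_stepSet] at h4
      obtain ⟨p, hp, hq⟩ := h4
      refine .inr ⟨hb, p, ⟨Function.update c j (i + 1), fun l hl hl' => ?_, fun l hl => ?_,
        fun i' hi' => ?_, ?_⟩, hq⟩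
      · rw [Function.update_apply] at hl'
        split_ifs at hl' with hlj
        · omega
        · have := h1 l hl hl'
          omega
      · rw [testBit_sub_two_pow hb, h2 l hl, Function.update_apply]
        split_ifs with hlj
        · simp [hlj]
        · simp [hlj]
      · rw [subword_congr (P' := fun l => c l = i') (fun _ _ => rfl) fun l _ => ?_]
        · exact h3 i' hi'
        · rw [Function.update_apply]
          split_ifs with hlj
          · subst hlj; omega
          · rfl
      · rw [subword_congr (P' := fun l => c l = i) (fun _ _ => rfl) fun l hl => ?_]
        · exact hp
        · rw [Function.update_of_ne hl.ne]
    · rw [subword, if_neg hc] at h4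
      refine .inl ⟨c, fun l hl hl' => ?_, h2, h3, h4⟩
      have := h1 l hl hl'
      have : l ≠ j := fun h => hc (h ▸ hl')
      omega
  · rintro (⟨c, h1, h2, h3, h4⟩ | ⟨hb, p, ⟨c, h1, h2, h3, h4⟩, hq⟩)
    · refine ⟨c, fun l hl hl' => (h1 l hl hl').trans (Nat.lt_succ_self j), h2, h3, ?_⟩
      rwa [subword, if_neg fun h => lt_irrefl _ (h1 j hj h)]
    · have hc : ¬ c j ≤ i := by
        rw [← h2 j hj, testBit_sub_two_pow hb]
        simp
      refine ⟨Function.update c j i, fun l hl hl' => ?_, fun l hl => ?_, fun i' hi' => ?_, ?_⟩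
      · rw [Function.update_apply] at hl'
        split_ifs at hl' with hlj
        · omega
        · have := h1 l hl hl'
          omega
      · rw [Function.update_apply]
        split_ifs with hlj
        · subst hlj; simpa using hb
        · rw [← h2 l hl, testBit_sub_two_pow hb]
          simp [hlj]
      · rw [subword_congr (P' := fun l => c l = i') (fun _ _ => rfl) fun l _ => ?_]
        · exact h3 i' hi'
        · rw [Function.update_apply]
          split_ifs with hlj
          · subst hlj; omega
          · rfl
      · rw [subword, if_pos (by simp), List.getElem?_eq_getElem hj, Option.toList_some,
          NFA.eval_append_singleton, NFA.mem_stepSet]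
        refine ⟨p, ?_, hq⟩
        rw [subword_congr (P' := fun l => c l = i) (fun _ _ => rfl) fun l hl => ?_]
        · exact h4
        · rw [Function.update_of_ne hl.ne]

theorem covers_succ {i : Fin t} (hM : L i = M.accepts) : Covers L w (i + 1) S ↔
    Covers L w i S ∨ ∃ q ∈ M.accept, Reaches L w i M w.length S q := by
  constructor
  · rintro ⟨c, h1, h2⟩
    rcases h2 i (Nat.lt_succ_self i) with h | h
    · rw [hM, NFA.mem_accepts] at h
      obtain ⟨q, hq, hq'⟩ := h
      refine .inr ⟨q, hq, c, fun l hl _ => hl, fun l hl => ?_, fun i' hi' => h2 i' (by omega), hq'⟩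
      rw [h1 l hl, Nat.lt_succ_iff]
    · refine .inl ⟨c, fun l hl => ?_, fun i' hi' => h2 i' (by omega)⟩
      have := (subword_eq_nil_iff le_rfl).1 h l hl
      rw [h1 l hl]
      omega
  · rintro (h | ⟨q, hq, c, -, h2, h3, h4⟩)
    · obtain ⟨c, h1, h2, h3⟩ := h.exists_ne
      refine ⟨c, fun l hl => ?_, fun i' hi' => ?_⟩
      · have := h1 l
        rw [h2 l hl]
        omega
      · obtain hi' | hi' : (i' : ℕ) < i ∨ (i' : ℕ) = i := by omega
        · exact h3 i' hi'
        · exact .inr ((subword_eq_nil_iff le_rfl).2 fun l _ => by rw [hi']; exact h1 l)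
    · refine ⟨c, fun l hl => ?_, fun i' hi' => ?_⟩
      · rw [h2 l hl, Nat.lt_succ_iff]
      · obtain hi' | hi' : (i' : ℕ) < i ∨ (i' : ℕ) = i := by omega
        · exact h3 i' hi'
        · obtain rfl : i' = i := Fin.ext hi'
          exact .inl (by rw [hM, NFA.mem_accepts]; exact ⟨q, hq, h4⟩)

theorem mem_shuffle_iff_covers : w ∈ shuffle L ↔ Covers L w t (2 ^ w.length - 1) := by
  have hbit : ∀ l < w.length, (2 ^ w.length - 1).testBit l := fun l hl => by
    simpa [Nat.testBit_two_pow_sub_one] using hl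
  constructor
  · rintro ⟨u, rfl, hu⟩
    refine ⟨fun l => (u[l]?.map fun x => (x.2 : ℕ)).getD t, fun l hl => ?_, fun i _ => ?_⟩
    · simp only [hbit l hl, true_iff]
      rw [List.length_map] at hl
      simp [hl]
    · have h := hu i
      rw [filter_map_eq_subword] at h
      rw [List.length_map, subword_congr (w' := u.map Prod.fst) (fun _ _ => rfl) fun l hl => ?_]
      · exact h
      · simp [hl, Fin.ext_iff]
  · rintro ⟨c, h1, h2⟩
    have hc : ∀ l : Fin w.length, c l < t := fun l => (h1 l l.2).1 (hbit l l.2)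
    have hw : (List.ofFn fun l : Fin w.length => (w[l], (⟨c l, hc l⟩ : Fin t))).map Prod.fst =
        w := by
      rw [List.map_ofFn]
      exact List.ofFn_getElem
    refine ⟨_, hw, fun i => ?_⟩
    rw [filter_map_eq_subword, hw, List.length_ofFn,
      subword_congr (P' := fun l => c l = i) (fun _ _ => rfl) fun l hl => ?_]
    · exact h2 i i.2
    · simp [hl, Fin.ext_iff]

/-- The test of the `j`-th bit by a comparison of residues. -/
theorem two_pow_le_mod_iff {S j : ℕ} : 2 ^ j ≤ S % (2 * 2 ^ j) ↔ S.testBit j := by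
  rw [Nat.testBit_eq_decide_div_mod_eq, decide_eq_true_iff, mul_comm, Nat.mod_mul]
  have h := Nat.mod_lt S (Nat.two_pow_pos j)
  rcases Nat.mod_two_eq_zero_or_one (S / 2 ^ j) with h' | h'
  · rw [h', mul_zero, add_zero]
    exact ⟨fun h'' => absurd h (Nat.not_lt.2 h''), fun h'' => absurd h'' (by norm_num)⟩
  · rw [h', mul_one]
    exact ⟨fun _ => rfl, fun _ => Nat.le_add_left _ _⟩

end Covering

/-! ### The layout of the input -/

section Lists

theorem getD_append_length_add {β : Type*} (l l' : List β) (r : ℕ) (d : β) :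
    (l ++ l').getD (l.length + r) d = l'.getD r d := by
  rw [List.getD_append_right _ _ _ _ (Nat.le_add_right _ _), Nat.add_sub_cancel_left]

/-- The entries of the `i`-th block of a concatenation of blocks. -/
theorem getD_flatMap {β γ : Type*} (l : List β) (f : β → List γ) (d : γ) {i r : ℕ}
    (hi : i < l.length) (hr : r < (f l[i]).length) :
    (l.flatMap f).getD (((l.take i).flatMap f).length + r) d = (f l[i]).getD r d := by
  conv_lhs => rw [← List.take_append_drop i l, List.drop_eq_getElem_cons hi]
  rw [List.flatMap_append, List.flatMap_cons]
  rw [show (l.take i ++ l[i] :: l.drop (i + 1)).take i = l.take i by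
    rw [← List.drop_eq_getElem_cons hi, List.take_append_drop], getD_append_length_add,
    List.getD_append _ _ _ _ hr]

theorem length_flatMap_of_forall {β γ : Type*} (l : List β) (f : β → List γ) {m : ℕ}
    (hm : ∀ x, (f x).length = m) : (l.flatMap f).length = l.length * m := by
  rw [List.length_flatMap, List.map_congr_left fun x _ => hm x]
  simp

theorem getD_flatMap_of_forall {β γ : Type*} (l : List β) (f : β → List γ) (d : γ) {m i r : ℕ}
    (hm : ∀ x, (f x).length = m) (hi : i < l.length) (hr : r < m) :
    (l.flatMap f).getD (i * m + r) d = (f l[i]).getD r d := by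
  have h := getD_flatMap l f d hi (by rwa [hm])
  rwa [length_flatMap_of_forall _ _ hm, List.length_take, min_eq_left hi.le] at h

theorem getD_map_finRange {γ : Type*} {n : ℕ} (f : Fin n → γ) (d : γ) (p : Fin n) :
    ((List.finRange n).map f).getD p d = f p := by
  simp [List.getD_eq_getElem?_getD]

end Lists

namespace ShuffleInstance

theorem bit_of_true {p : Prop} (h : p) : bit p = 1 := if_pos h

theorem bit_of_false {p : Prop} (h : ¬ p) : bit p = 0 := if_neg h

theorem bit_pos_iff {p : Prop} : 0 < bit p ↔ p := by
  by_cases h : p <;> simp [bit, h]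

theorem bit_congr {p q : Prop} (h : p ↔ q) : bit p = bit q := by rw [propext h]

section NFA

variable {g n : ℕ} (M : NFA (Fin g) (Fin n))

theorem length_encodeNFA : (encodeNFA M).length = 1 + n + n + n * (n * g) := by
  have h : ∀ p : Fin n, ((List.finRange n).flatMap (fun q =>
      (List.finRange g).map (fun a => bit (q ∈ M.step p a)))).length = n * g := fun p => by
    rw [length_flatMap_of_forall (m := g) _ _ fun x => by simp, List.length_finRange]
  simp only [encodeNFA, List.length_append, length_flatMap_of_forall (m := n * g) _ _ h]
  simp

theorem encodeNFA_zero : (encodeNFA M).getD 0 0 = n := rfl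

theorem encodeNFA_start (p : Fin n) : (encodeNFA M).getD (1 + p) 0 = bit (p ∈ M.start) := by
  have h := getD_append_length_add [(n : ℤ)] ((List.finRange n).map fun p => bit (p ∈ M.start)) p 0
  rw [getD_map_finRange] at h
  rw [encodeNFA, List.getD_append _ _ _ _ (by simp; omega),
    List.getD_append _ _ _ _ (by simp; omega), ← h]
  rfl

theorem encodeNFA_accept (p : Fin n) :
    (encodeNFA M).getD (1 + n + p) 0 = bit (p ∈ M.accept) := by
  rw [encodeNFA, List.getD_append _ _ _ _ (by simp; omega)]
  have h := getD_append_length_add ([(n : ℤ)] ++ (List.finRange n).map fun p => bit (p ∈ M.start))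
    ((List.finRange n).map fun p => bit (p ∈ M.accept)) p 0
  rw [getD_map_finRange] at h
  rw [← h]
  simp [add_comm]

theorem encodeNFA_step (p q : Fin n) (a : Fin g) :
    (encodeNFA M).getD (1 + n + n + ((p * n + q) * g + a)) 0 = bit (q ∈ M.step p a) := by
  have h : ∀ p : Fin n, ((List.finRange n).flatMap (fun q =>
      (List.finRange g).map (fun a => bit (q ∈ M.step p a)))).length = n * g := fun p => by
    rw [length_flatMap_of_forall (m := g) _ _ fun x => by simp, List.length_finRange]
  have hlen : 1 + n + n = ([(n : ℤ)] ++ (List.finRange n).map (fun p => bit (p ∈ M.start)) ++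
    (List.finRange n).map (fun p => bit (p ∈ M.accept))).length := by simp; omega
  have hq : (q : ℕ) * g + a < n * g :=
    calc (q : ℕ) * g + a < q * g + g := by omega
      _ = (q + 1) * g := by ring
      _ ≤ n * g := Nat.mul_le_mul_right _ q.2
  rw [encodeNFA, hlen, getD_append_length_add, show ((p : ℕ) * n + q) * g + a =
    p * (n * g) + (q * g + a) by ring, getD_flatMap_of_forall _ _ _ h (by simp) hq,
    getD_flatMap_of_forall (m := g) _ _ _ (fun x => by simp) (by simp) a.2, getD_map_finRange]
  simp

theorem mem_encodeNFA {x : ℤ} (hx : x ∈ encodeNFA M) : x = n ∨ x = 0 ∨ x = 1 := by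
  have hbit : ∀ p : Prop, bit p = 0 ∨ bit p = 1 := fun p => by
    by_cases h : p <;> simp [bit, h]
  simp only [encodeNFA, List.mem_append, List.mem_singleton, List.mem_map, List.mem_flatMap] at hx
  rcases hx with ((rfl | ⟨p, -, rfl⟩) | ⟨p, -, rfl⟩) | ⟨p, -, q, -, a, -, rfl⟩
  · exact .inl rfl
  all_goals exact .inr (hbit _)

end NFA

variable (I : ShuffleInstance)

/-- In the definition of `encode` the letters are coerced by a monadic bind; here it is a map. -/
theorem encode_eq : I.encode = [(I.k : ℤ), (I.t : ℤ), (I.g : ℤ)] ++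
    I.w.map (fun a : Fin I.g => ((a : ℕ) : ℤ)) ++
      (List.finRange I.t).flatMap fun i => encodeNFA (I.B i) := by
  simp [encode, ← List.map_eq_flatMap, Function.comp_def]

/-- The address of the `i`-th automaton; for `i = t` it is the first address after the input. -/
noncomputable def base (i : ℕ) : ℕ :=
  3 + I.k + (((List.finRange I.t).take i).flatMap fun i => encodeNFA (I.B i)).length

theorem base_zero : I.base 0 = 3 + I.k := by simp [base]

theorem base_succ (i : Fin I.t) :
    I.base (i + 1) = I.base i + (1 + I.n i + I.n i + I.n i * (I.n i * I.g)) := by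
  rw [base, base, List.take_succ_eq_append_getElem (by simp), List.flatMap_append]
  simp [length_encodeNFA, add_assoc]

theorem base_t : I.base I.t = I.encode.length := by
  rw [base, List.take_of_length_le (by simp), encode]
  simp only [List.length_append, List.length_map]
  simp [k]

theorem base_mono {i i' : ℕ} (h : i ≤ i') : I.base i ≤ I.base i' := by
  obtain ⟨d, rfl⟩ := Nat.exists_eq_add_of_le h
  rw [base, base, List.take_add, List.flatMap_append, List.length_append]
  omega

theorem n_le_b (i : Fin I.t) : I.n i ≤ I.b := Finset.le_sup (Finset.mem_univ i)

theorem base_le (i : ℕ) (hi : i ≤ I.t) :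
    I.base i ≤ 3 + I.k + i * (1 + I.b + I.b + I.b * (I.b * I.g)) := by
  induction i with
  | zero => simp [base_zero]
  | succ i ih =>
    have h := I.n_le_b ⟨i, hi⟩
    have h' : I.n ⟨i, hi⟩ * (I.n ⟨i, hi⟩ * I.g) ≤ I.b * (I.b * I.g) := by gcongr
    have hs := I.base_succ ⟨i, hi⟩
    simp only at hs
    rw [hs, Nat.succ_mul]
    have := ih (by omega)
    omega

theorem encode_k : I.encode.getD 0 0 = I.k := rfl

theorem encode_t : I.encode.getD 1 0 = I.t := rfl

theorem encode_g : I.encode.getD 2 0 = I.g := rfl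

theorem encode_w {j : ℕ} (hj : j < I.w.length) :
    I.encode.getD (3 + j) 0 = ((I.w[j] : ℕ) : ℤ) := by
  have h := getD_append_length_add [(I.k : ℤ), (I.t : ℤ), (I.g : ℤ)]
    (I.w.map (fun a : Fin I.g => ((a : ℕ) : ℤ)) ++
      (List.finRange I.t).flatMap fun i => encodeNFA (I.B i)) j 0
  rw [encode_eq, List.append_assoc]
  refine h.trans ?_
  rw [List.getD_append _ _ _ _ (by simpa using hj)]
  simp [List.getD_eq_getElem?_getD, hj]

theorem encode_base_add (i : Fin I.t) {r : ℕ}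
    (hr : r < 1 + I.n i + I.n i + I.n i * (I.n i * I.g)) :
    I.encode.getD (I.base i + r) 0 = (encodeNFA (I.B i)).getD r 0 := by
  have h : ([(I.k : ℤ), (I.t : ℤ), (I.g : ℤ)] ++
      I.w.map (fun a : Fin I.g => ((a : ℕ) : ℤ))).length = 3 + I.k := by
    simp [k]; omega
  have hi : (List.finRange I.t)[(i : ℕ)]'(by simp) = i := by simp
  rw [encode_eq, base, ← h, add_assoc, getD_append_length_add,
    getD_flatMap _ _ _ (by simp) (by simpa only [length_encodeNFA, hi] using hr), hi]

theorem encode_base (i : Fin I.t) : I.encode.getD (I.base i) 0 = I.n i := by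
  rw [← encodeNFA_zero (I.B i), ← encode_base_add I i (by omega), add_zero]

theorem encode_start (i : Fin I.t) (p : Fin (I.n i)) :
    I.encode.getD (I.base i + (1 + p)) 0 = bit (p ∈ (I.B i).start) := by
  rw [encode_base_add I i (by omega), encodeNFA_start]

theorem encode_accept (i : Fin I.t) (p : Fin (I.n i)) :
    I.encode.getD (I.base i + (1 + I.n i + p)) 0 = bit (p ∈ (I.B i).accept) := by
  rw [encode_base_add I i (by omega), encodeNFA_accept]

theorem table_index_lt {n g p q a : ℕ} (hp : p < n) (hq : q < n) (ha : a < g) :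
    (p * n + q) * g + a < n * (n * g) :=
  calc (p * n + q) * g + a < (p * n + q) * g + g := by omega
    _ = (p * n + (q + 1)) * g := by ring
    _ ≤ (p * n + n) * g := by gcongr; omega
    _ = (p + 1) * (n * g) := by ring
    _ ≤ n * (n * g) := Nat.mul_le_mul_right _ hp

theorem encode_step (i : Fin I.t) (p q : Fin (I.n i)) (a : Fin I.g) :
    I.encode.getD (I.base i + (1 + I.n i + I.n i + ((p * I.n i + q) * I.g + a))) 0 =
      bit (q ∈ (I.B i).step p a) := by
  have := table_index_lt p.2 q.2 a.2
  rw [encode_base_add I i (by omega), encodeNFA_step]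

theorem encode_bounds (z : ℕ) :
    0 ≤ I.encode.getD z 0 ∧ I.encode.getD z 0 ≤ (I.k + I.t + I.b + I.g + 1 : ℕ) := by
  have H : ∀ x ∈ I.encode, 0 ≤ x ∧ x ≤ (I.k + I.t + I.b + I.g + 1 : ℕ) := by
    intro x hx
    simp only [encode_eq, List.mem_append, List.mem_map, List.mem_flatMap, List.mem_cons,
      List.not_mem_nil, or_false] at hx
    rcases hx with ((rfl | rfl | rfl) | ⟨a, -, rfl⟩) | ⟨i, -, hx⟩
    · omega
    · omega
    · omega
    · have := a.2
      omega
    · have := I.n_le_b i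
      rcases mem_encodeNFA _ hx with rfl | rfl | rfl <;> omega
  by_cases hz : z < I.encode.length
  · rw [List.getD_eq_getElem _ _ hz]
    exact H _ (List.getElem_mem hz)
  · rw [List.getD_eq_default _ _ (by omega)]
    omega

end ShuffleInstance

/-! ### The tables of the dynamic program in the memory -/

namespace RAM

open ShuffleInstance

theorem mul_add_inj {N q q' S S' : ℕ} (hS : S < N) (hS' : S' < N)
    (h : q * N + S = q' * N + S') : q = q' ∧ S = S' := by
  have hq : q = q' := by
    have h1 : (q * N + S) / N = q := by
      rw [mul_comm, Nat.mul_add_div (by omega), Nat.div_eq_of_lt hS, add_zero]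
    have h2 : (q' * N + S') / N = q' := by
      rw [mul_comm, Nat.mul_add_div (by omega), Nat.div_eq_of_lt hS', add_zero]
    rw [← h1, h, h2]
  subst hq
  exact ⟨rfl, by omega⟩

theorem mul_add_lt {n N q S : ℕ} (hq : q < n) (hS : S < N) : q * N + S < n * N :=
  calc q * N + S < q * N + N := by omega
    _ = (q + 1) * N := by ring
    _ ≤ n * N := Nat.mul_le_mul_right _ hq

/-- The memory `μ` holds the input of the machine, after it the table of the predicate `D`, and from
the address `R` on the tables of the predicates `F q`; everything after these tables is zero. -/
structure Tables (I : ShuffleInstance) (W R : ℕ) {n : ℕ} (D : ℕ → Prop) (F : Fin n → ℕ → Prop)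
    (μ : ℕ → ℤ) : Prop where
  fits : ∀ z, 0 ≤ μ z ∧ (μ z).natAbs < 2 ^ W
  input : ∀ z < I.base I.t, μ z = I.encode.getD z 0
  cover : ∀ S < 2 ^ I.k, μ (I.base I.t + S) = bit (D S)
  reach : ∀ (q : Fin n), ∀ S < 2 ^ I.k, μ (R + q * 2 ^ I.k + S) = bit (F q S)
  zero : ∀ z, R + n * 2 ^ I.k ≤ z → μ z = 0

variable {I : ShuffleInstance} {W R n : ℕ} {D : ℕ → Prop} {F : Fin n → ℕ → Prop} {μ : ℕ → ℤ}

theorem Tables.congr {D' : ℕ → Prop} {F' : Fin n → ℕ → Prop} (h : Tables I W R D F μ)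
    (hD : ∀ S < 2 ^ I.k, D S ↔ D' S) (hF : ∀ q, ∀ S < 2 ^ I.k, F q S ↔ F' q S) :
    Tables I W R D' F' μ where
  fits := h.fits
  input := h.input
  cover S hS := by rw [h.cover S hS, bit_congr (hD S hS)]
  reach q S hS := by rw [h.reach q S hS, bit_congr (hF q S hS)]
  zero := h.zero

/-- The zeros after the tables are the tables of false predicates. -/
theorem Tables.extend {F₀ : Fin 0 → ℕ → Prop} (h : Tables I W R D F₀ μ) (n : ℕ) :
    Tables I W R (n := n) D (fun _ _ => False) μ where
  fits := h.fits
  input := h.input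
  cover := h.cover
  reach q S hS := by
    rw [bit_of_false id]
    exact h.zero _ (by omega)
  zero z hz := h.zero z (by omega)

theorem Tables.forget (h : Tables I W R D F μ) (F₀ : Fin 0 → ℕ → Prop) :
    Tables I W (R + n * 2 ^ I.k) D F₀ μ where
  fits := h.fits
  input := h.input
  cover := h.cover
  reach q := q.elim0
  zero z hz := h.zero z (by omega)

theorem rowMem_fits (h : Tables I W R D F μ) (hW : 1 < 2 ^ W) (A dA X dX Y dY m N n z : ℕ) :
    0 ≤ rowMem μ A dA X dX Y dY m N n z ∧ (rowMem μ A dA X dX Y dY m N n z).natAbs < 2 ^ W := by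
  rcases rowMem_eq_one_or μ A dA X dX Y dY m N n z with h' | h' <;> rw [h']
  · exact ⟨zero_le_one, hW⟩
  · exact h.fits z

theorem ite_one_bit {p q : Prop} [Decidable p] : (if p then 1 else bit q) = bit (q ∨ p) := by
  by_cases hp : p <;> by_cases hq : q <;> simp [hp, hq, bit]

/-- A row of joins writing to the tables at `R`. -/
theorem Tables.rowMem_reach (h : Tables I W R D F μ) (hW : 1 < 2 ^ W)
    (hR : I.base I.t + 2 ^ I.k ≤ R) {A dA X m : ℕ} {T : Fin n → Prop} {G : ℕ → Prop}
    (hA : ∀ q : Fin n, μ (A + q * dA) = bit (T q))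
    (hX : ∀ S < 2 ^ I.k, m ≤ S % (2 * m) → (0 < μ (X + S - m) ↔ G S)) :
    Tables I W R D (fun q S => F q S ∨ m ≤ S % (2 * m) ∧ T q ∧ G S)
      (rowMem μ A dA X 0 R (2 ^ I.k) m (2 ^ I.k) n) := by
  have hV : ∀ q < n, ∀ S < 2 ^ I.k, m ≤ S % (2 * m) →
      (fun z => R ≤ z ∧ z < R + n * 2 ^ I.k) (R + q * 2 ^ I.k + S) := fun q hq S hS _ => by
    have := mul_add_lt hq hS
    exact ⟨by omega, by omega⟩
  have hN := Nat.two_pow_pos I.k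
  refine ⟨rowMem_fits h hW _ _ _ _ _ _ _ _ _, fun z hz => ?_, fun S hS => ?_, fun q S hS => ?_,
    fun z hz => ?_⟩
  · rw [rowMem_of_not (V := fun z => R ≤ z ∧ z < R + n * 2 ^ I.k) hV fun h' => ?_, h.input z hz]
    omega
  · rw [rowMem_of_not (V := fun z => R ≤ z ∧ z < R + n * 2 ^ I.k) hV fun h' => ?_, h.cover S hS]
    omega
  · rw [rowMem, h.reach q S hS, ite_one_bit]
    refine bit_congr (or_congr_right ⟨?_, ?_⟩)
    · rintro ⟨q', hq', S', hS', h1, h2, h3, h4⟩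
      obtain ⟨hqq, rfl⟩ := mul_add_inj (q := q) (q' := q') hS hS' (by omega)
      rw [← hqq, hA, bit_pos_iff] at h2
      rw [mul_zero, add_zero, hX S hS h1] at h3
      exact ⟨h1, h2, h3⟩
    · rintro ⟨h1, h2, h3⟩
      refine ⟨q, q.2, S, hS, h1, ?_, ?_, rfl⟩
      · rwa [hA, bit_pos_iff]
      · rwa [mul_zero, add_zero, hX S hS h1]
  · rw [rowMem_of_not (V := fun z => R ≤ z ∧ z < R + n * 2 ^ I.k) hV fun h' => ?_, h.zero z hz]
    omega

/-- A row of joins of all tables at `R` into the first table. -/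
theorem Tables.rowMem_cover (h : Tables I W R D F μ) (hW : 1 < 2 ^ W)
    (hR : I.base I.t + 2 ^ I.k ≤ R) {A : ℕ} {T : Fin n → Prop}
    (hA : ∀ q : Fin n, μ (A + q * 1) = bit (T q)) :
    Tables I W R (fun S => D S ∨ ∃ q, T q ∧ F q S) F
      (rowMem μ A 1 R (2 ^ I.k) (I.base I.t) 0 0 (2 ^ I.k) n) := by
  have hV : ∀ q < n, ∀ S < 2 ^ I.k, 0 ≤ S % (2 * 0) →
      (fun z => I.base I.t ≤ z ∧ z < R) (I.base I.t + q * 0 + S) := fun q hq S hS _ =>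
    ⟨by omega, by omega⟩
  have hN := Nat.two_pow_pos I.k
  refine ⟨rowMem_fits h hW _ _ _ _ _ _ _ _ _, fun z hz => ?_, fun S hS => ?_, fun q S hS => ?_,
    fun z hz => ?_⟩
  · rw [rowMem_of_not (V := fun z => I.base I.t ≤ z ∧ z < R) hV fun h' => ?_, h.input z hz]
    omega
  · rw [rowMem, h.cover S hS, ite_one_bit]
    refine bit_congr (or_congr_right ⟨?_, ?_⟩)
    · rintro ⟨q, hq, S', hS', -, h2, h3, h4⟩
      obtain rfl : S = S' := by omega
      have h2' := hA ⟨q, hq⟩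
      have h3' := h.reach ⟨q, hq⟩ S hS
      rw [h2', bit_pos_iff] at h2
      rw [Nat.sub_zero, h3', bit_pos_iff] at h3
      exact ⟨_, h2, h3⟩
    · rintro ⟨q, h2, h3⟩
      refine ⟨q, q.2, S, hS, Nat.zero_le _, ?_, ?_, by omega⟩
      · rwa [hA, bit_pos_iff]
      · rwa [Nat.sub_zero, h.reach q S hS, bit_pos_iff]
  · rw [rowMem_of_not (V := fun z => I.base I.t ≤ z ∧ z < R) hV fun h' => ?_, h.reach q S hS]
    omega
  · rw [rowMem_of_not (V := fun z => I.base I.t ≤ z ∧ z < R) hV fun h' => ?_, h.zero z hz]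
    omega

/-! ### Programs for one automaton -/

/-- Add the content of register `a` to register `d` as often as register `3` tells. -/
def addLoop (d a : ℕ) : Prog :=
  .loop 3 (.ofList [.instr (.add d d a), .instr (.sub 3 3 60)])

variable {bc : ℕ → ℕ}

theorem wp_addLoop {s : State} {d a n x : ℕ} (hd : d ≠ 3) (hd' : d ≠ 60) (ha : a ≠ 3)
    (had : a ≠ d) (hsd : s.reg d = 0) (hsa : s.reg a = x) (h3 : s.reg 3 = n) (h60 : s.reg 60 = 1)
    (hx : n * x < 2 ^ W) (hn : n < 2 ^ W) :
    wp bc W (addLoop d a) s fun s' T => (∀ r, r ≠ d → r ≠ 3 → s'.reg r = s.reg r) ∧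
      s'.mem = s.mem ∧ s'.reg d = (n * x : ℕ) ∧ T ≤ 3 * n + 1 := by
  refine (wp_loop n (fun i s' => (∀ r, r ≠ d → r ≠ 3 → s'.reg r = s.reg r) ∧ s'.mem = s.mem ∧
    s'.reg d = (i * x : ℕ) ∧ s'.reg 3 = n - i) 2 ?_ ?_ ?_).mono ?_
  · simp [hsd, h3]
  · rintro i s' - ⟨-, -, -, h⟩
    exact h
  · rintro i s' hi ⟨hf, hm, hd₁, h3₁⟩
    have hix := Nat.mul_le_mul_right x (Nat.succ_le_of_lt hi)
    have g60 : s'.reg 60 = 1 := by rw [hf _ hd'.symm (by norm_num), h60]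
    have ga : s'.reg a = x := by rw [hf _ had ha, hsa]
    rw [Nat.succ_mul] at hix
    have hsum : (s'.reg d + s'.reg a) = ((i + 1) * x : ℕ) := by rw [hd₁, ga]; push_cast; ring
    simp only [wp_add, wp_sub, wp_ofList_nil, State.reg_set, if_neg hd.symm, if_neg hd'.symm, h3₁,
      g60, hsum, State.mem_set]
    refine ⟨by rw [Int.natAbs_natCast, Nat.succ_mul]; omega, by omega,
      ⟨fun r hr hr' => ?_, hm, ?_, ?_⟩, by omega⟩
    · rw [if_neg hr', if_neg hr, hf r hr hr']
    · rw [if_neg hd, if_pos trivial]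
    · rw [if_pos trivial]
      push_cast
      ring
  · rintro s' T ⟨⟨hf, hm, hd₁, -⟩, hT⟩
    exact ⟨hf, hm, hd₁, by omega⟩

/-- Advance register `50` from the address of an automaton to the address after it. -/
def advanceProg : Prog := .ofList [
  .instr (.load 1 50),
  .instr (.const 2 0),
  .instr (.move 3 1),
  addLoop 2 64,
  .instr (.const 4 0),
  .instr (.move 3 1),
  addLoop 4 2,
  .instr (.add 50 50 60),
  .instr (.add 50 50 1),
  .instr (.add 50 50 1),
  .instr (.add 50 50 4)]

theorem wp_advanceProg {s : State} {a n g : ℕ} (h50 : s.reg 50 = a) (hn : s.mem a = n)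
    (h60 : s.reg 60 = 1) (h64 : s.reg 64 = g)
    (hW : a + (1 + n + n + n * (n * g)) < 2 ^ W) :
    wp bc W advanceProg s fun s' T => (∀ r, 10 ≤ r → r ≠ 50 → s'.reg r = s.reg r) ∧
      s'.mem = s.mem ∧ s'.reg 50 = (a + (1 + n + n + n * (n * g)) : ℕ) ∧ T ≤ 6 * n + 12 := by
  have hng : n * g ≤ n * (n * g) := by
    rcases Nat.eq_zero_or_pos n with rfl | h
    · simp
    · exact Nat.le_mul_of_pos_left _ h
  simp only [advanceProg, wp_load, wp_const, wp_move]
  simp [h50, hn]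
  refine ⟨by omega, wp_ofList_cons ((wp_addLoop (n := n) (x := g) (by norm_num)
    (by norm_num) (by norm_num) (by norm_num) (by simp) (by simp [h64]) (by simp) (by simp [h60])
    (by omega) (by omega)).mono ?_)⟩
  rintro s₁ T₁ ⟨hf₁, hm₁, hd₁, hT₁⟩
  have e1 : s₁.reg 1 = n := by rw [hf₁ _ (by norm_num) (by norm_num)]; simp
  have e50 : s₁.reg 50 = a := by rw [hf₁ _ (by norm_num) (by norm_num)]; simp [h50]
  have e60 : s₁.reg 60 = 1 := by rw [hf₁ _ (by norm_num) (by norm_num)]; simp [h60]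
  simp only [wp_const, wp_move]
  simp [e1]
  refine ⟨by omega, wp_ofList_cons ((wp_addLoop (n := n) (x := n * g) (by norm_num)
    (by norm_num) (by norm_num) (by norm_num) (by simp) (by simp [hd₁]) (by simp) (by simp [e60])
    (by omega) (by omega)).mono ?_)⟩
  rintro s₂ T₂ ⟨hf₂, hm₂, hd₂, hT₂⟩
  have d1 : s₂.reg 1 = n := by rw [hf₂ _ (by norm_num) (by norm_num)]; simp [e1]
  have d50 : s₂.reg 50 = a := by rw [hf₂ _ (by norm_num) (by norm_num)]; simp [e50]
  have d60 : s₂.reg 60 = 1 := by rw [hf₂ _ (by norm_num) (by norm_num)]; simp [e60]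
  simp only [wp_add, wp_ofList_nil]
  simp only [State.reg_set, State.mem_set, d1, d50, d60, hd₂, Nat.reduceEqDiff, if_true, if_false]
  refine ⟨by omega, by omega, by omega, by omega, fun r hr hr' => ?_, ?_, by push_cast; ring,
    by omega⟩
  · rw [if_neg hr', if_neg hr', if_neg hr', if_neg hr', hf₂ r (by omega) (by omega)]
    simp only [State.reg_set]
    rw [if_neg (by omega), if_neg (by omega), hf₁ r (by omega) (by omega)]
    simp only [State.reg_set]
    rw [if_neg (by omega), if_neg (by omega), if_neg (by omega)]
  · rw [hm₂, State.mem_set, State.mem_set, hm₁]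
    simp

end RAM

/-! ### Reading one letter -/

namespace RAM

open ShuffleInstance

variable {bc : ℕ → ℕ} {W : ℕ}

/-- Let the current automaton possibly read the letter whose address is in register `31`. Register
`20` holds `2 ^ j` for the position `j` of the letter, and register `32` counts the states `p`. -/
def stepProg : Prog := .ofList [
  .instr (.load 12 31),
  .instr (.add 12 12 50),
  .instr (.add 12 12 60),
  .instr (.add 12 12 22),
  .instr (.add 12 12 22),
  .instr (.move 10 51),
  .instr (.move 32 22),
  .loop 32 (.ofList [
    .instr (.move 11 51),
    rowProg,
    .instr (.add 10 10 61),
    .instr (.sub 32 32 60)]),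
  .instr (.add 20 20 20),
  .instr (.add 31 31 60),
  .instr (.sub 30 30 60)]

/-- The registers whose content is the same for all automata. -/
structure Globals (I : ShuffleInstance) (s : State) : Prop where
  one : s.reg 60 = 1
  tableSize : s.reg 61 = (2 ^ I.k : ℕ)
  length : s.reg 62 = I.k
  letters : s.reg 64 = I.g
  inputEnd : s.reg 65 = I.base I.t

theorem Globals.congr {I : ShuffleInstance} {s s' : State} (h : Globals I s)
    (hs : ∀ r, 60 ≤ r → s'.reg r = s.reg r) : Globals I s' where
  one := by rw [hs _ (by norm_num), h.one]
  tableSize := by rw [hs _ (by norm_num), h.tableSize]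
  length := by rw [hs _ (by norm_num), h.length]
  letters := by rw [hs _ (by norm_num), h.letters]
  inputEnd := by rw [hs _ (by norm_num), h.inputEnd]

variable {I : ShuffleInstance}

/-- The languages of the automata of an instance. -/
def languages (I : ShuffleInstance) (i : Fin I.t) : Language (Fin I.g) := (I.B i).accepts

theorem wp_stepProg {s : State} {i : Fin I.t} {R j : ℕ} (hG : Globals I s)
    (hR : I.base I.t + 2 ^ I.k ≤ R) (hRW : R + I.n i * 2 ^ I.k + 2 ^ I.k + I.g < 2 ^ W)
    (hj : j < I.w.length) (h20 : s.reg 20 = (2 ^ j : ℕ)) (h22 : s.reg 22 = I.n i)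
    (h23 : s.reg 23 = I.g) (h24 : s.reg 24 = 0) (h25 : s.reg 25 = (2 ^ I.k : ℕ))
    (h30 : s.reg 30 = (I.k : ℤ) - j) (h31 : s.reg 31 = (3 + j : ℕ)) (h50 : s.reg 50 = I.base i)
    (h51 : s.reg 51 = R)
    (hT : Tables I W R (Covers (languages I) I.w i)
      (fun q S => Reaches (languages I) I.w i (I.B i) j S q) s.mem) :
    wp bc W stepProg s fun s' T =>
      (∀ r, 15 ≤ r → r ≠ 20 → r ≠ 30 → r ≠ 31 → r ≠ 32 → s'.reg r = s.reg r) ∧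
      s'.reg 20 = (2 ^ (j + 1) : ℕ) ∧ s'.reg 30 = (I.k : ℤ) - (j + 1 : ℕ) ∧
      s'.reg 31 = (3 + (j + 1) : ℕ) ∧
      Tables I W R (Covers (languages I) I.w i)
        (fun q S => Reaches (languages I) I.w i (I.B i) (j + 1) S q) s'.mem ∧
      T ≤ I.n i * (I.n i * (20 * 2 ^ I.k + 12) + 6) + 11 := by
  obtain ⟨h60, h61, h62, h64, h65⟩ := hG
  have hjk : j < I.k := hj
  have hm : 2 * 2 ^ j ≤ 2 ^ I.k := by
    rw [← pow_succ']
    exact Nat.pow_le_pow_right (by norm_num) hjk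
  have hN := Nat.two_pow_pos I.k
  have hbs := I.base_succ i
  have hbE : I.base (i + 1) ≤ I.base I.t := I.base_mono i.2
  have hb0 : 3 + I.k ≤ I.base i := I.base_zero ▸ I.base_mono (Nat.zero_le _)
  set N := 2 ^ I.k with hN'
  obtain ⟨a, ha⟩ : ∃ a, a = I.w[j]'hj := ⟨_, rfl⟩
  have ha' := a.2
  have hnn : I.g ≤ I.n i * (I.n i * I.g) ∨ I.n i = 0 := by
    rcases Nat.eq_zero_or_pos (I.n i) with h | h
    · exact .inr h
    · rw [← mul_assoc]
      exact .inl (Nat.le_mul_of_pos_left _ (Nat.mul_pos h h))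
  have hload : s.mem (3 + j) = (a : ℕ) := by
    rw [hT.input _ (by omega), I.encode_w hj, ha]
  simp only [stepProg, wp_load, wp_add, wp_move]
  simp only [State.reg_set, h31, Int.toNat_natCast, hload, h50, h60, h22, h51, Nat.reduceEqDiff,
    if_true, if_false]
  refine ⟨by omega, by omega, by omega, by omega, by omega, by omega, by omega, by omega, ?_⟩
  -- After `p` rows, the letter has been read from the states less than `p`.
  refine wp_ofList_cons ((wp_loop (I.n i) (fun p s' =>
    (∀ r, 15 ≤ r → r ≠ 32 → s'.reg r = s.reg r) ∧ s'.reg 10 = (R + p * N : ℕ) ∧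
    s'.reg 12 = (I.base i + (1 + I.n i + I.n i + ((p * I.n i + 0) * I.g + a)) : ℕ) ∧
    s'.reg 32 = I.n i - p ∧
    Tables I W R (Covers (languages I) I.w i) (fun q S =>
      Reaches (languages I) I.w i (I.B i) j S q ∨ S.testBit j ∧ ∃ p' : Fin (I.n i), (p' : ℕ) < p ∧
        Reaches (languages I) I.w i (I.B i) j (S - 2 ^ j) p' ∧ q ∈ (I.B i).step p' a) s'.mem)
    (I.n i * (20 * N + 12) + 5) ?_ ?_ ?_).mono ?_)
  · refine ⟨fun r hr hr' => ?_, ?_, ?_, ?_, ?_⟩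
    · simp only [State.reg_set]
      split_ifs <;> omega
    · simp
    · simp
      ring
    · simp
    · exact hT.congr (fun S _ => Iff.rfl) fun q S _ => by simp
  · rintro p s' - ⟨-, -, -, h, -⟩
    exact h
  · rintro p s' hp ⟨hf, g10, g12, g32, hT'⟩
    have hpN := Nat.mul_le_mul_right N (Nat.succ_le_of_lt hp)
    rw [Nat.succ_mul] at hpN
    have g20 : s'.reg 20 = (2 ^ j : ℕ) := by rw [hf _ (by norm_num) (by norm_num), h20]
    have g22 : s'.reg 22 = I.n i := by rw [hf _ (by norm_num) (by norm_num), h22]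
    have g23 : s'.reg 23 = I.g := by rw [hf _ (by norm_num) (by norm_num), h23]
    have g24 : s'.reg 24 = 0 := by rw [hf _ (by norm_num) (by norm_num), h24]
    have g25 : s'.reg 25 = N := by rw [hf _ (by norm_num) (by norm_num), h25]
    have g51 : s'.reg 51 = R := by rw [hf _ (by norm_num) (by norm_num), h51]
    have g60 : s'.reg 60 = 1 := by rw [hf _ (by norm_num) (by norm_num), h60]
    have g61 : s'.reg 61 = N := by rw [hf _ (by norm_num) (by norm_num), h61]
    have hAq : ∀ q, I.base i + (1 + I.n i + I.n i + ((p * I.n i + 0) * I.g + a)) + q * I.g =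
        I.base i + (1 + I.n i + I.n i + ((p * I.n i + q) * I.g + a)) := fun q => by ring
    have hAlt : ∀ q < I.n i,
        I.base i + (1 + I.n i + I.n i + ((p * I.n i + q) * I.g + a)) < I.base I.t := by
      intro q hq
      have := table_index_lt hp hq ha'
      omega
    have hA : ∀ q : Fin (I.n i),
        s'.mem (I.base i + (1 + I.n i + I.n i + ((p * I.n i + 0) * I.g + a)) + q * I.g) =
        bit (q ∈ (I.B i).step ⟨p, hp⟩ a) := fun q => by
      rw [hAq, hT'.input _ (hAlt q q.2)]
      exact I.encode_step i ⟨p, hp⟩ q a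
    have hAn : I.base i + (1 + I.n i + I.n i + ((p * I.n i + 0) * I.g + a)) + I.n i * I.g <
        2 ^ W := by
      have h1 : (p + 1) * (I.n i * I.g) ≤ I.n i * (I.n i * I.g) := Nat.mul_le_mul_right _ hp
      have h2 : (p * I.n i + 0) * I.g + I.n i * I.g = (p + 1) * (I.n i * I.g) := by ring
      omega
    -- The entries that are read belong to sets without `j`, so earlier rows have not written them.
    have hX : ∀ S < N, 2 ^ j ≤ S % (2 * 2 ^ j) → (0 < s'.mem (R + p * N + S - 2 ^ j) ↔
        Reaches (languages I) I.w i (I.B i) j (S - 2 ^ j) ⟨p, hp⟩) := by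
      intro S hS hSj
      rw [two_pow_le_mod_iff] at hSj
      have hle := two_pow_le_of_testBit hSj
      have hr := hT'.reach ⟨p, hp⟩ (S - 2 ^ j) (by omega)
      rw [show R + p * N + S - 2 ^ j = R + p * N + (S - 2 ^ j) by omega, hr, bit_pos_iff]
      have hb : ¬ (S - 2 ^ j).testBit j := by rw [testBit_sub_two_pow hSj]; simp
      simp [hb]
    have hnext := hT'.rowMem_reach (by omega) hR hA hX
    simp only [wp_move, g51]
    refine ⟨by omega, wp_ofList_cons ((wp_rowProg (s := s'.set 11 R) (X := R + p * N) (Y := R)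
      (A := I.base i + (1 + I.n i + I.n i + ((p * I.n i + 0) * I.g + a))) (dA := I.g) (dX := 0)
      (dY := N) (m := 2 ^ j) (N := N) (n := I.n i)
      (by rw [State.reg_set, if_neg (by norm_num), g10]) (by rw [State.reg_set, if_pos rfl])
      (by rw [State.reg_set, if_neg (by norm_num), g12])
      (by rw [State.reg_set, if_neg (by norm_num), g20])
      (by rw [State.reg_set, if_neg (by norm_num), g22])
      (by rw [State.reg_set, if_neg (by norm_num), g23])
      (by rw [State.reg_set, if_neg (by norm_num), g24]; rfl)
      (by rw [State.reg_set, if_neg (by norm_num), g25])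
      (by rw [State.reg_set, if_neg (by norm_num), g60])
      (by rw [State.reg_set, if_neg (by norm_num), g61]) hT'.fits hAn (by omega) (by omega)
      (by omega) hm hN
      (fun z => ∃ q S, S < N ∧ S.testBit j ∧ z = R + q * N + S)
      (fun q _ S hS hSj => ⟨q, S, hS, two_pow_le_mod_iff.1 hSj, rfl⟩) ?_ ?_).mono ?_)⟩
    · rintro q - S hS hSj ⟨q', S', hS', hSj', h⟩
      rw [two_pow_le_mod_iff] at hSj
      have hle := two_pow_le_of_testBit hSj
      obtain ⟨-, rfl⟩ := mul_add_inj (N := N) (q := p) (q' := q') (S := S - 2 ^ j) (by omega) hS'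
        (by omega)
      rw [testBit_sub_two_pow hSj] at hSj'
      exact hSj'.1 rfl
    · rintro q hq ⟨q', S', -, -, h⟩
      rw [hAq] at h
      have := hAlt q hq
      omega
    · rintro s₁ T₁ ⟨hf₁, hμ₁, d10, -, d12, hT₁⟩
      have d60 : s₁.reg 60 = 1 := by
        rw [hf₁ _ (by norm_num), State.reg_set, if_neg (by norm_num), g60]
      have d61 : s₁.reg 61 = N := by
        rw [hf₁ _ (by norm_num), State.reg_set, if_neg (by norm_num), g61]
      have d32 : s₁.reg 32 = I.n i - p := by
        rw [hf₁ _ (by norm_num), State.reg_set, if_neg (by norm_num), g32]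
      simp only [wp_add, wp_sub, wp_ofList_nil]
      simp only [State.reg_set, State.mem_set, d10, d12, d32, d60, d61, Nat.reduceEqDiff, if_true,
        if_false]
      refine ⟨by omega, by omega, ⟨fun r hr hr' => ?_, ?_, ?_, ?_, ?_⟩, by omega⟩
      · rw [if_neg hr', if_neg (by omega), hf₁ r hr, State.reg_set, if_neg (by omega), hf r hr hr']
      · push_cast
        ring
      · push_cast
        ring
      · push_cast
        ring
      · rw [hμ₁]
        refine hnext.congr (fun S _ => Iff.rfl) fun q S _ => ?_
        rw [two_pow_le_mod_iff, or_assoc, ← and_or_left]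
        refine or_congr_right (and_congr_right fun _ => ?_)
        constructor
        · rintro (⟨p', h1, h2⟩ | ⟨h1, h2⟩)
          · exact ⟨p', by omega, h2⟩
          · exact ⟨⟨p, hp⟩, Nat.lt_succ_self p, h2, h1⟩
        · rintro ⟨p', h1, h2, h3⟩
          obtain h | h : (p' : ℕ) < p ∨ (p' : ℕ) = p := by omega
          · exact .inl ⟨p', h, h2, h3⟩
          · obtain rfl : p' = ⟨p, hp⟩ := Fin.ext h
            exact .inr ⟨h3, h2⟩
  · rintro s' T ⟨⟨hf, -, -, -, hT'⟩, hTime⟩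
    have g20 : s'.reg 20 = (2 ^ j : ℕ) := by rw [hf _ (by norm_num) (by norm_num), h20]
    have g30 : s'.reg 30 = I.k - j := by rw [hf _ (by norm_num) (by norm_num), h30]
    have g31 : s'.reg 31 = (3 + j : ℕ) := by rw [hf _ (by norm_num) (by norm_num), h31]
    have g60 : s'.reg 60 = 1 := by rw [hf _ (by norm_num) (by norm_num), h60]
    replace hTime : T ≤ 1 + I.n i * (I.n i * (20 * N + 12) + 6) := hTime
    simp only [wp_add, wp_sub, wp_ofList_nil]
    simp only [State.reg_set, State.mem_set, g20, g30, g31, g60, Nat.reduceEqDiff, if_true,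
      if_false]
    refine ⟨by omega, by omega, by omega, fun r hr h20 h30 h31 h32 => ?_, ?_, ?_, ?_, ?_, ?_⟩
    · rw [if_neg h30, if_neg h31, if_neg h20, hf r hr h32]
    · rw [pow_succ]
      push_cast
      ring
    · push_cast
      ring
    · push_cast
      ring
    · refine hT'.congr (fun S _ => Iff.rfl) fun q S _ => ?_
      rw [reaches_succ hj]
      refine or_congr_right (and_congr_right fun _ => exists_congr fun p => ?_)
      rw [← ha]
      exact ⟨fun h => h.2, fun h => ⟨p.2, h⟩⟩
    · omega

end RAM

/-! ### Processing one automaton -/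

namespace RAM

open ShuffleInstance

variable {bc : ℕ → ℕ} {W : ℕ} {I : ShuffleInstance}

/-- Process one automaton, whose address is in register `50`. Register `51` holds the address of
free memory. -/
def stageProg : Prog := .ofList [
  .instr (.load 22 50),
  .instr (.add 12 50 60),
  .instr (.move 10 65),
  .instr (.move 11 51),
  .instr (.const 20 0),
  .instr (.move 23 60),
  .instr (.const 24 0),
  .instr (.move 25 61),
  rowProg,
  .instr (.const 20 1),
  .instr (.move 30 62),
  .instr (.const 31 3),
  .instr (.move 23 64),
  .loop 30 stepProg,
  .instr (.const 20 0),
  .instr (.move 23 60),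
  .instr (.move 24 61),
  .instr (.const 25 0),
  .instr (.add 12 50 60),
  .instr (.add 12 12 22),
  .instr (.move 10 51),
  .instr (.move 11 65),
  rowProg,
  .instr (.move 51 10),
  advanceProg]

theorem wp_stageProg {s : State} {i : Fin I.t} {R : ℕ} (hG : Globals I s)
    (hR : I.base I.t + 2 ^ I.k ≤ R) (hRW : R + I.n i * 2 ^ I.k + 2 ^ I.k + I.g < 2 ^ W)
    (h50 : s.reg 50 = I.base i) (h51 : s.reg 51 = R)
    (hT : Tables I W R (Covers (languages I) I.w i) (fun q : Fin 0 => q.elim0) s.mem) :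
    wp bc W stageProg s fun s' T => (∀ r, 52 ≤ r → s'.reg r = s.reg r) ∧
      s'.reg 50 = I.base (i + 1) ∧ s'.reg 51 = (R + I.n i * 2 ^ I.k : ℕ) ∧
      Tables I W (R + I.n i * 2 ^ I.k) (Covers (languages I) I.w (i + 1))
        (fun q : Fin 0 => q.elim0) s'.mem ∧
      T ≤ I.k * (I.n i * (I.n i * (20 * 2 ^ I.k + 12) + 6) + 12) +
        2 * (I.n i * (20 * 2 ^ I.k + 12)) + 6 * I.n i + 40 := by
  have hG' := hG
  obtain ⟨h60, h61, h62, h64, h65⟩ := hG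
  have hk : I.k < 2 ^ I.k := Nat.lt_two_pow_self
  have hbs := I.base_succ i
  have hbE : I.base (i + 1) ≤ I.base I.t := I.base_mono i.2
  have hb0 : 3 + I.k ≤ I.base i := I.base_zero ▸ I.base_mono (Nat.zero_le _)
  have hnN : I.n i ≤ I.n i * 2 ^ I.k := Nat.le_mul_of_pos_right _ (by omega)
  set N := 2 ^ I.k with hN'
  have hn0 : s.mem (I.base i) = I.n i := by rw [hT.input _ (by omega), I.encode_base]
  -- The tables of the initial states.
  simp only [stageProg, wp_load, wp_add, wp_move, wp_const]
  simp only [State.reg_set, h50, h51, h60, h61, h65, hn0, Int.toNat_natCast, Nat.reduceEqDiff,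
    if_false]
  refine ⟨by omega, by omega, by omega, by omega, by omega, by omega, by omega, by omega, by omega,
    ?_⟩
  have hA : ∀ q : Fin (I.n i), s.mem (I.base i + 1 + q * 1) = bit (q ∈ (I.B i).start) := fun q => by
    rw [mul_one, add_assoc, hT.input _ (by omega), I.encode_start]
  have hT₀ := (hT.extend (I.n i)).rowMem_reach (by omega) hR (m := 0) hA
    (X := I.base I.t) (G := Covers (languages I) I.w i) fun S hS _ => by
      rw [Nat.sub_zero, hT.cover S hS, bit_pos_iff]
  refine wp_ofList_cons ((wp_rowProg (X := I.base I.t) (Y := R) (A := I.base i + 1) (dA := 1)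
    (dX := 0) (dY := N) (m := 0) (N := N) (n := I.n i) (by simp) (by simp) (by simp) (by simp)
    (by simp) (by simp) (by simp) (by simp) (by simp [h60]) (by simp [h61])
    (by exact hT.fits) (by omega) (by omega) (by omega) (by omega) (by omega) (by omega)
    (fun z => R ≤ z)
    (fun q _ S _ _ => ?_)
    (fun q _ S hS _ => ?_) fun q hq => ?_).mono ?_)
  · omega
  · omega
  · omega
  rintro s₁ T₁ ⟨hf₁, hμ₁, -, -, -, hT₁⟩
  replace hT₀ : Tables I W R (Covers (languages I) I.w i)
      (fun q S => Reaches (languages I) I.w i (I.B i) 0 S q) s₁.mem := by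
    rw [hμ₁]
    refine hT₀.congr (fun S _ => Iff.rfl) fun q S _ => ?_
    rw [reaches_zero, and_comm (a := Covers _ _ _ _)]
    simp
  have e22 : s₁.reg 22 = I.n i := by rw [hf₁ _ (by norm_num)]; simp
  have e24 : s₁.reg 24 = 0 := by rw [hf₁ _ (by norm_num)]; simp
  have e25 : s₁.reg 25 = N := by rw [hf₁ _ (by norm_num)]; simp
  have hf₁' : ∀ r, 50 ≤ r → s₁.reg r = s.reg r := fun r hr => by
    rw [hf₁ r (by omega)]
    simp only [State.reg_set]
    split_ifs <;> omega
  have e62 : s₁.reg 62 = I.k := by rw [hf₁' _ (by norm_num), h62]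
  have e64 : s₁.reg 64 = I.g := by rw [hf₁' _ (by norm_num), h64]
  -- The letters are read one after the other.
  simp only [wp_move, wp_const]
  simp only [State.reg_set, e62, e64, Nat.reduceEqDiff, if_false]
  refine ⟨by omega, by omega, by omega, by omega, ?_⟩
  refine wp_ofList_cons ((wp_loop I.k (fun j s' => (∀ r, 50 ≤ r → s'.reg r = s.reg r) ∧
    s'.reg 20 = (2 ^ j : ℕ) ∧ s'.reg 22 = I.n i ∧ s'.reg 23 = I.g ∧ s'.reg 24 = 0 ∧
    s'.reg 25 = N ∧ s'.reg 30 = (I.k : ℤ) - j ∧ s'.reg 31 = (3 + j : ℕ) ∧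
    Tables I W R (Covers (languages I) I.w i)
      (fun q S => Reaches (languages I) I.w i (I.B i) j S q) s'.mem)
    (I.n i * (I.n i * (20 * N + 12) + 6) + 11) ?_ ?_ ?_).mono ?_)
  · refine ⟨fun r hr => ?_, by simp, by simp [e22], by simp, by simp [e24], by simp [e25],
      by simp, by simp, hT₀⟩
    rw [← hf₁' r hr]
    simp only [State.reg_set]
    split_ifs <;> omega
  · rintro j s' - ⟨-, -, -, -, -, -, h, -⟩
    exact h
  · rintro j s' hj ⟨hf, d20, d22, d23, d24, d25, d30, d31, hT'⟩
    refine (wp_stepProg (hG'.congr fun r hr => hf r (by omega)) hR hRW hj d20 d22 d23 d24 d25 d30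
      d31 (by rw [hf _ (by norm_num), h50]) (by rw [hf _ (by norm_num), h51]) hT').mono ?_
    rintro s₂ T₂ ⟨hf₂, c20, c30, c31, hT₂, hTime⟩
    refine ⟨⟨fun r hr => ?_, c20, ?_, ?_, ?_, ?_, c30, c31, hT₂⟩, hTime⟩
    · rw [hf₂ r (by omega) (by omega) (by omega) (by omega) (by omega), hf r hr]
    · rw [hf₂ _ (by norm_num) (by norm_num) (by norm_num) (by norm_num) (by norm_num), d22]
    · rw [hf₂ _ (by norm_num) (by norm_num) (by norm_num) (by norm_num) (by norm_num), d23]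
    · rw [hf₂ _ (by norm_num) (by norm_num) (by norm_num) (by norm_num) (by norm_num), d24]
    · rw [hf₂ _ (by norm_num) (by norm_num) (by norm_num) (by norm_num) (by norm_num), d25]
  rintro s₂ T₂ ⟨⟨hf₂, -, e22, -, -, -, -, -, hT₂⟩, hTime₂⟩
  replace hTime₂ : T₂ ≤ 1 + I.k * (I.n i * (I.n i * (20 * N + 12) + 6) + 12) := hTime₂
  have e50 : s₂.reg 50 = I.base i := by rw [hf₂ _ (by norm_num), h50]
  have e51 : s₂.reg 51 = R := by rw [hf₂ _ (by norm_num), h51]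
  have e60 : s₂.reg 60 = 1 := by rw [hf₂ _ (by norm_num), h60]
  have e61 : s₂.reg 61 = N := by rw [hf₂ _ (by norm_num), h61]
  have e65 : s₂.reg 65 = I.base I.t := by rw [hf₂ _ (by norm_num), h65]
  -- The tables of the final states are joined into the first table.
  simp only [wp_move, wp_const, wp_add]
  simp only [State.reg_set, e22, e50, e51, e60, e61, e65, Nat.reduceEqDiff, if_true, if_false]
  refine ⟨by omega, by omega, by omega, by omega, by omega, by omega, by omega, by omega, ?_⟩
  have hA : ∀ q : Fin (I.n i), s₂.mem (I.base i + 1 + I.n i + q * 1) =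
      bit (q ∈ (I.B i).accept) := fun q => by
    rw [mul_one, add_assoc, add_assoc, ← add_assoc 1, hT₂.input _ (by omega), I.encode_accept]
  have hT₃ := hT₂.rowMem_cover (by omega) hR hA
  refine wp_ofList_cons ((wp_rowProg (X := R) (Y := I.base I.t) (A := I.base i + 1 + I.n i)
    (dA := 1) (dX := N) (dY := 0) (m := 0) (N := N) (n := I.n i) (by simp) (by simp)
    (by simp) (by simp) (by simp [e22]) (by simp) (by simp) (by simp) (by simp [e60])
    (by simp [e61]) (by exact hT₂.fits)
    (by omega) (by omega) (by omega) (by omega) (by omega) (by omega)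
    (fun z => I.base I.t ≤ z ∧ z < R) (fun q _ S _ _ => ?_)
    (fun q _ S hS _ => ?_) fun q hq => ?_).mono ?_)
  · omega
  · omega
  · omega
  rintro s₃ T₃ ⟨hf₃, hμ₃, d10, -, -, hTime₃⟩
  have hf₃' : ∀ r, 50 ≤ r → s₃.reg r = s.reg r := fun r hr => by
    rw [hf₃ r (by omega), ← hf₂ r hr]
    simp only [State.reg_set]
    split_ifs <;> omega
  have hn₃ : s₃.mem (I.base i) = I.n i := by
    rw [hμ₃]
    exact (hT₃.input _ (by omega)).trans (I.encode_base i)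
  simp only [wp_move]
  refine ⟨by rw [d10]; omega, wp_ofList_cons ((wp_advanceProg (a := I.base i) (n := I.n i)
    (g := I.g) ?_ ?_ ?_ ?_ (by omega)).mono ?_)⟩
  · simp [hf₃', h50]
  · simpa using hn₃
  · simp [hf₃', h60]
  · simp [hf₃', h64]
  rintro s₄ T₄ ⟨hf₄, hμ₄, c50, hTime₄⟩
  refine wp_ofList_nil.2 ⟨fun r hr => ?_, ?_, ?_, ?_, ?_⟩
  · rw [hf₄ r (by omega) (by omega), State.reg_set, if_neg (by omega), hf₃' r (by omega)]
  · rw [c50, hbs]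
  · rw [hf₄ _ (by norm_num) (by norm_num), State.reg_set, if_pos rfl, d10]
  · rw [hμ₄, State.mem_set, hμ₃]
    refine (hT₃.congr (fun S _ => ?_) fun q S _ => Iff.rfl).forget _
    exact (covers_succ (M := I.B i) rfl).symm
  · clear * - hT₁ hTime₂ hTime₃ hTime₄
    generalize I.k * (I.n i * (I.n i * (20 * N + 12) + 6) + 12) = x at hTime₂ ⊢
    generalize I.n i * (20 * N + 12) = y at hT₁ hTime₃ ⊢
    linarith

end RAM

/-! ### The program for Shuffle Membership -/

namespace RAM

open ShuffleInstance

variable {bc : ℕ → ℕ} {W : ℕ} {I : ShuffleInstance}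

/-- Shuffle Membership for nonempty words. The registers `60`, `62`, `63`, `64` hold `1`, `k`, `t`
and the number of letters. -/
def solveProg : Prog := .ofList [
  .instr (.move 61 60),
  .instr (.move 1 62),
  .loop 1 (.ofList [.instr (.add 61 61 61), .instr (.sub 1 1 60)]),
  .instr (.const 50 3),
  .instr (.add 50 50 62),
  .instr (.move 52 63),
  .loop 52 (.ofList [advanceProg, .instr (.sub 52 52 60)]),
  .instr (.move 65 50),
  .instr (.store 65 60),
  .instr (.add 51 65 61),
  .instr (.const 50 3),
  .instr (.add 50 50 62),
  .instr (.move 52 63),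
  .loop 52 (.ofList [stageProg, .instr (.sub 52 52 60)]),
  .instr (.add 1 65 61),
  .instr (.sub 1 1 60),
  .instr (.load 0 1)]

/-- An upper bound for the time to process an automaton with `b` states. -/
def stageTime (k b : ℕ) : ℕ :=
  k * (b * (b * (20 * 2 ^ k + 12) + 6) + 12) + 2 * (b * (20 * 2 ^ k + 12)) + 6 * b + 40

theorem stageTime_mono {k n b : ℕ} (h : n ≤ b) : stageTime k n ≤ stageTime k b := by
  unfold stageTime
  gcongr

/-- The memory before the first automaton: `1` has been stored right after the input, as the entry
of the empty set in the table of `Covers 0`. -/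
theorem tables_start
    (hW : I.base I.t + (I.t * I.b + 2) * 2 ^ I.k + I.k + I.t + I.b + I.g + 5 < 2 ^ W) :
    Tables I W (I.base I.t + 2 ^ I.k) (Covers (languages I) I.w 0) (fun q : Fin 0 => q.elim0)
      (Function.update (fun z => I.encode.getD z 0) (I.base I.t) 1) where
  fits z := by
    rw [Function.update_apply]
    split_ifs
    · exact ⟨zero_le_one, by rw [Int.natAbs_one]; omega⟩
    · have := I.encode_bounds z
      exact ⟨this.1, by omega⟩
  input z hz := by rw [Function.update_of_ne hz.ne]
  cover S hS := by
    rw [bit_congr (covers_zero hS), Function.update_apply]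
    by_cases h : S = 0
    · simp [h, bit]
    · rw [if_neg (by omega), List.getD_eq_default _ _ (by rw [← base_t]; omega), bit_of_false h]
  reach q := q.elim0
  zero z hz := by
    have := Nat.two_pow_pos I.k
    rw [Function.update_of_ne (by omega), List.getD_eq_default _ _ (by rw [← base_t]; omega)]

theorem wp_solveProg {s : State} (hW : I.base I.t + (I.t * I.b + 2) * 2 ^ I.k + I.k + I.t + I.b +
      I.g + 5 < 2 ^ W)
    (h60 : s.reg 60 = 1) (h62 : s.reg 62 = I.k) (h63 : s.reg 63 = I.t) (h64 : s.reg 64 = I.g)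
    (hmem : s.mem = fun z => I.encode.getD z 0) :
    wp bc W solveProg s fun s' T => s'.reg 0 = bit I.IsYes ∧
      T ≤ 3 * I.k + I.t * (6 * I.b + 14) + I.t * (stageTime I.k I.b + 2) + 30 := by
  have hb0 : I.base 0 = 3 + I.k := I.base_zero
  have hN := Nat.two_pow_pos I.k
  rw [Nat.add_mul] at hW
  -- The number of subsets.
  simp only [solveProg, wp_move]
  simp only [State.reg_set, h60, h62, Nat.reduceEqDiff, if_false]
  refine ⟨by rw [Int.natAbs_one]; omega, by omega, ?_⟩
  refine wp_ofList_cons ((wp_loop I.k (fun i s' => (∀ r, r ≠ 1 → r ≠ 61 → s'.reg r = s.reg r) ∧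
    s'.reg 1 = I.k - i ∧ s'.reg 61 = (2 ^ i : ℕ) ∧ s'.mem = s.mem) 2 ?_ ?_ ?_).mono ?_)
  · refine ⟨fun r hr hr' => ?_, by simp, by simp, rfl⟩
    rw [State.reg_set, if_neg hr, State.reg_set, if_neg hr']
  · rintro i s' - ⟨-, h, -⟩
    exact h
  · rintro i s' hi ⟨hf, g1, g61, hm⟩
    have hpow : 2 ^ (i + 1) ≤ 2 ^ I.k := Nat.pow_le_pow_right (by norm_num) hi
    have g60 : s'.reg 60 = 1 := by rw [hf _ (by norm_num) (by norm_num), h60]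
    rw [pow_succ] at hpow
    simp only [wp_add, wp_sub, wp_ofList_nil]
    simp only [State.reg_set, g1, g60, g61, Nat.reduceEqDiff, if_true, if_false]
    refine ⟨by omega, by omega, ⟨fun r hr hr' => ?_, ?_, ?_, hm⟩, by omega⟩
    · rw [if_neg hr, if_neg hr', hf r hr hr']
    · push_cast
      ring
    · push_cast
      ring
  rintro s₁ T₁ ⟨⟨hf₁, -, e61, hm₁⟩, hT₁⟩
  have e60 : s₁.reg 60 = 1 := by rw [hf₁ _ (by norm_num) (by norm_num), h60]
  have e62 : s₁.reg 62 = I.k := by rw [hf₁ _ (by norm_num) (by norm_num), h62]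
  have e63 : s₁.reg 63 = I.t := by rw [hf₁ _ (by norm_num) (by norm_num), h63]
  have e64 : s₁.reg 64 = I.g := by rw [hf₁ _ (by norm_num) (by norm_num), h64]
  -- The end of the input.
  simp only [wp_const, wp_add, wp_move]
  simp only [State.reg_set, e62, e63, Nat.reduceEqDiff, if_true, if_false]
  refine ⟨by omega, by omega, by omega, ?_⟩
  refine wp_ofList_cons ((wp_loop I.t (fun i s' =>
    (∀ r, 10 ≤ r → r ≠ 50 → r ≠ 52 → s'.reg r = s₁.reg r) ∧ s'.reg 52 = I.t - i ∧
    s'.reg 50 = I.base i ∧ s'.mem = s.mem) (6 * I.b + 13) ?_ ?_ ?_).mono ?_)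
  · refine ⟨fun r hr hr' hr'' => ?_, by simp, by simp [hb0], hm₁⟩
    rw [State.reg_set, if_neg hr'', State.reg_set, if_neg hr', State.reg_set, if_neg hr']
  · rintro i s' - ⟨-, h, -⟩
    exact h
  · rintro i s' hi ⟨hf, g52, g50, hm⟩
    have hbs := I.base_succ ⟨i, hi⟩
    have hbE : I.base (i + 1) ≤ I.base I.t := I.base_mono hi
    have hnb := I.n_le_b ⟨i, hi⟩
    simp only at hbs
    refine wp_ofList_cons ((wp_advanceProg (a := I.base i) (n := I.n ⟨i, hi⟩) (g := I.g) g50 ?_ ?_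
      ?_ (by omega)).mono ?_)
    · rw [hm, hmem]
      exact I.encode_base ⟨i, hi⟩
    · rw [hf _ (by norm_num) (by norm_num) (by norm_num), e60]
    · rw [hf _ (by norm_num) (by norm_num) (by norm_num), e64]
    rintro s₂ T₂ ⟨hf₂, hm₂, d50, hT₂⟩
    have d52 : s₂.reg 52 = I.t - i := by rw [hf₂ _ (by norm_num) (by norm_num), g52]
    have d60 : s₂.reg 60 = 1 := by
      rw [hf₂ _ (by norm_num) (by norm_num), hf _ (by norm_num) (by norm_num) (by norm_num), e60]
    simp only [wp_sub, wp_ofList_nil]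
    simp only [State.reg_set, d50, d52, d60, Nat.reduceEqDiff, if_true, if_false]
    refine ⟨by omega, ⟨fun r hr hr' hr'' => ?_, ?_, ?_, ?_⟩, by omega⟩
    · rw [if_neg hr'', hf₂ r hr hr', hf r hr hr' hr'']
    · push_cast
      ring
    · rw [hbs]
    · rw [State.mem_set, hm₂, hm]
  rintro s₂ T₂ ⟨⟨hf₂, -, d50, hm₂⟩, hT₂⟩
  replace hT₂ : T₂ ≤ 1 + I.t * (6 * I.b + 14) := hT₂
  have d60 : s₂.reg 60 = 1 := by
    rw [hf₂ _ (by norm_num) (by norm_num) (by norm_num), e60]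
  have d61 : s₂.reg 61 = (2 ^ I.k : ℕ) := by
    rw [hf₂ _ (by norm_num) (by norm_num) (by norm_num), e61]
  have d62 : s₂.reg 62 = I.k := by
    rw [hf₂ _ (by norm_num) (by norm_num) (by norm_num), e62]
  have d63 : s₂.reg 63 = I.t := by
    rw [hf₂ _ (by norm_num) (by norm_num) (by norm_num), e63]
  have d64 : s₂.reg 64 = I.g := by
    rw [hf₂ _ (by norm_num) (by norm_num) (by norm_num), e64]
  -- The automata are processed one after the other.
  simp only [wp_const, wp_add, wp_move, wp_store]
  simp only [State.reg_set, State.reg_put, d50, d60, d61, d62, d63, Nat.reduceEqDiff, if_true,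
    if_false, Int.toNat_natCast]
  refine ⟨by omega, by omega, by omega, by omega, by omega, by omega, ?_⟩
  refine wp_ofList_cons ((wp_loop I.t (fun i s' => Globals I s' ∧ s'.reg 52 = I.t - i ∧
    s'.reg 50 = I.base i ∧ ∃ R, I.base I.t + 2 ^ I.k ≤ R ∧
      R ≤ I.base I.t + 2 ^ I.k + i * (I.b * 2 ^ I.k) ∧ s'.reg 51 = R ∧
      Tables I W R (Covers (languages I) I.w i) (fun q : Fin 0 => q.elim0) s'.mem)
    (stageTime I.k I.b + 1) ?_ ?_ ?_).mono ?_)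
  · refine ⟨⟨by simp [d60], by simp [d61], by simp [d62], by simp [d64], by simp⟩, by simp,
      by simp [hb0], _, le_rfl, by omega, by simp, ?_⟩
    simp only [State.mem_set, State.mem_put, hm₂, hmem]
    exact tables_start (by rw [Nat.add_mul]; exact hW)
  · rintro i s' - ⟨-, h, -⟩
    exact h
  · rintro i s' hi ⟨hG, g52, g50, R, hR, hR', g51, hT⟩
    have hnb : I.n ⟨i, hi⟩ * 2 ^ I.k ≤ I.b * 2 ^ I.k := Nat.mul_le_mul_right _ (I.n_le_b ⟨i, hi⟩)
    have hit := Nat.mul_le_mul_right (I.b * 2 ^ I.k) (Nat.succ_le_of_lt hi)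
    rw [← mul_assoc I.t, Nat.succ_mul] at hit
    refine wp_ofList_cons ((wp_stageProg (i := ⟨i, hi⟩) hG hR (by omega) g50 g51 hT).mono ?_)
    rintro s₃ T₃ ⟨hf₃, c50, c51, hT₃, hTime₃⟩
    have hTime : T₃ ≤ stageTime I.k I.b := hTime₃.trans (stageTime_mono (I.n_le_b ⟨i, hi⟩))
    have c52 : s₃.reg 52 = I.t - i := by rw [hf₃ _ (by norm_num), g52]
    have c60 : s₃.reg 60 = 1 := by rw [hf₃ _ (by norm_num), hG.one]
    simp only [wp_sub, wp_ofList_nil]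
    simp only [State.reg_set, c50, c51, c52, c60, Nat.reduceEqDiff, if_true, if_false]
    refine ⟨by omega, ⟨hG.congr fun r hr => ?_, ?_, trivial, R + I.n ⟨i, hi⟩ * 2 ^ I.k, by omega,
      ?_, rfl, hT₃⟩, by omega⟩
    · rw [State.reg_set, if_neg (by omega), hf₃ r (by omega)]
    · push_cast
      ring
    · rw [Nat.succ_mul]
      omega
  rintro s₃ T₃ ⟨⟨hG, -, -, R, -, -, -, hT⟩, hTime₃⟩
  replace hTime₃ : T₃ ≤ 1 + I.t * (stageTime I.k I.b + 2) := hTime₃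
  -- The answer is the entry of the set of all positions.
  have hlast := hT.cover (2 ^ I.k - 1) (by omega)
  have hyes : bit (Covers (languages I) I.w I.t (2 ^ I.k - 1)) = bit I.IsYes :=
    bit_congr mem_shuffle_iff_covers.symm
  have haddr : ((I.base I.t : ℤ) + (2 ^ I.k : ℕ) - 1).toNat = I.base I.t + (2 ^ I.k - 1) := by omega
  have hbit : (bit I.IsYes).natAbs ≤ 1 := by
    by_cases h : I.IsYes <;> simp [bit, h]
  simp only [wp_add, wp_sub, wp_load, wp_ofList_nil]
  simp only [State.reg_set, State.mem_set, hG.one, hG.inputEnd, hG.tableSize, Nat.reduceEqDiff,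
    if_true, if_false, haddr, hlast, hyes]
  refine ⟨by omega, by omega, by omega, by omega, trivial, ?_⟩
  clear * - hT₁ hT₂ hTime₃
  linarith

/-- Read the parameters and treat the trivial cases `k = 0` and `t = 0`. -/
def shuffleProg : Prog := .ofList [
  .instr (.const 60 1),
  .instr (.load 62 0),
  .instr (.load 63 60),
  .instr (.const 1 2),
  .instr (.load 64 1),
  .ite 62 (.ite 63 solveProg .skip) (.ofList [.instr (.const 0 1)])]

theorem isYes_of_k_eq_zero (hk : I.k = 0) : I.IsYes := by
  have hw : I.w = [] := List.length_eq_zero_iff.1 hk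
  exact ⟨[], by simp [hw], fun i => .inr rfl⟩

theorem not_isYes_of_t_eq_zero (hk : 0 < I.k) (ht : I.t = 0) : ¬ I.IsYes := by
  rintro ⟨u, hu, -⟩
  cases u with
  | nil =>
    have hk' : I.w.length ≠ 0 := hk.ne'
    rw [← hu] at hk'
    exact hk' rfl
  | cons x u => exact (Fin.cast ht x.2).elim0

theorem wp_shuffleProg
    (hW : I.base I.t + (I.t * I.b + 2) * 2 ^ I.k + I.k + I.t + I.b + I.g + 5 < 2 ^ W) :
    wp bc W shuffleProg (State.ofInput I.encode) fun s T => s.reg 0 = bit I.IsYes ∧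
      (T ≤ 10 ∨ 0 < I.k ∧ 0 < I.t ∧
        T ≤ 3 * I.k + I.t * (6 * I.b + 14) + I.t * (stageTime I.k I.b + 2) + 40) := by
  have hm : (State.ofInput I.encode).mem = fun z => I.encode.getD z 0 := rfl
  have h0 : ∀ r, (State.ofInput I.encode).reg r = 0 := fun _ => rfl
  simp only [shuffleProg, wp_const, wp_load]
  simp only [State.reg_set, State.mem_set, h0, hm, Nat.reduceEqDiff, if_true, if_false,
    Int.toNat_zero, Int.toNat_one, Int.reduceToNat, encode_k, encode_t, encode_g]
  refine ⟨by rw [Int.natAbs_one]; omega, le_rfl, by omega, zero_le_one, by omega, by omega,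
    by norm_num, by omega, ?_⟩
  refine wp_ofList_cons
    (wp_ite (fun hk => wp_ite (fun ht => ?_) fun ht => wp_skip.2 ?_) fun hk => ?_)
  · simp at hk ht
    refine (wp_solveProg hW (by simp) (by simp) (by simp) (by simp) rfl).mono ?_
    rintro s T ⟨hs, hT⟩
    exact wp_ofList_nil.2 ⟨hs, .inr ⟨hk, ht, by omega⟩⟩
  · simp at hk ht
    refine wp_ofList_nil.2 ⟨?_, .inl (by norm_num)⟩
    rw [bit_of_false (not_isYes_of_t_eq_zero hk ht)]
    simp [h0]
  · simp at hk
    refine wp_const.2 ⟨by rw [Int.natAbs_one]; omega, wp_ofList_nil.2 (wp_ofList_nil.2 ⟨?_,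
      .inl (by norm_num)⟩)⟩
    rw [bit_of_true (isYes_of_k_eq_zero hk)]
    simp

/-! ### Word length and running time -/

/-- Words of `8 * (k + log (t + b + g + 1) + 1)` bits can hold all addresses: with
`Z = 2 ^ (k + log (t + b + g + 1) + 1)`, all of `k`, `t`, `b`, `g`, `2 ^ k` are at most `Z`, and the
left-hand side is bounded by a polynomial of degree four in them. -/
theorem addresses_lt (I : ShuffleInstance) :
    I.base I.t + (I.t * I.b + 2) * 2 ^ I.k + I.k + I.t + I.b + I.g + 5 <
      2 ^ (8 * (I.k + Nat.log 2 (I.t + I.b + I.g + 1) + 1)) := by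
  have hs : I.t + I.b + I.g + 1 < 2 ^ (Nat.log 2 (I.t + I.b + I.g + 1) + 1) :=
    Nat.lt_pow_succ_log_self (by norm_num) _
  have hs' : 2 ^ (Nat.log 2 (I.t + I.b + I.g + 1) + 1) ≤
      2 ^ (I.k + Nat.log 2 (I.t + I.b + I.g + 1) + 1) :=
    Nat.pow_le_pow_right (by norm_num) (by omega)
  have hN : 2 ^ I.k ≤ 2 ^ (I.k + Nat.log 2 (I.t + I.b + I.g + 1) + 1) :=
    Nat.pow_le_pow_right (by norm_num) (by omega)
  have hk : I.k < 2 ^ I.k := Nat.lt_two_pow_self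
  have hZ : 2 ^ 1 ≤ 2 ^ (I.k + Nat.log 2 (I.t + I.b + I.g + 1) + 1) :=
    Nat.pow_le_pow_right (by norm_num) (by omega)
  have hbase := I.base_le I.t le_rfl
  rw [mul_comm 8, pow_mul]
  generalize 2 ^ (I.k + Nat.log 2 (I.t + I.b + I.g + 1) + 1) = Z at *
  generalize 2 ^ I.k = N at *
  generalize I.base I.t = E at *
  have ht : I.t ≤ Z := by omega
  have hb : I.b ≤ Z := by omega
  have hg : I.g ≤ Z := by omega
  have h1 : I.t * (1 + I.b + I.b + I.b * (I.b * I.g)) ≤ Z * (1 + Z + Z + Z * (Z * Z)) := by gcongr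
  have h2 : (I.t * I.b + 2) * N ≤ (Z * Z + 2) * Z := by gcongr
  have h3 : 2 * Z ≤ Z * Z := Nat.mul_le_mul_right _ hZ
  have h4 : 2 * Z ^ 2 ≤ Z * Z ^ 2 := Nat.mul_le_mul_right _ hZ
  have h5 : 2 * Z ^ 3 ≤ Z * Z ^ 3 := Nat.mul_le_mul_right _ hZ
  have h6 : 2 * Z ^ 4 ≤ Z * Z ^ 4 := Nat.mul_le_mul_right _ hZ
  have h7 : 2 * Z ^ 5 ≤ Z * Z ^ 5 := Nat.mul_le_mul_right _ hZ
  have h8 : 2 * Z ^ 6 ≤ Z * Z ^ 6 := Nat.mul_le_mul_right _ hZ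
  have h9 : 2 * Z ^ 7 ≤ Z * Z ^ 7 := Nat.mul_le_mul_right _ hZ
  ring_nf at *
  omega

theorem stageTime_le {k b : ℕ} (hk : 0 < k) :
    stageTime k b ≤ 160 * (2 ^ k * k * (b ^ 2 + 1)) := by
  have hN : 1 ≤ 2 ^ k := Nat.one_le_two_pow
  rw [stageTime]
  generalize 2 ^ k = N at *
  have h1 : b ≤ b ^ 2 := Nat.le_self_pow (by norm_num) b
  have h2 : b ^ 2 ≤ N * b ^ 2 := Nat.le_mul_of_pos_left _ hN
  have h3 : b * (b * (20 * N + 12) + 6) + 12 ≤ 50 * (N * (b ^ 2 + 1)) := by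
    ring_nf at *
    omega
  have h4 : 2 * (b * (20 * N + 12)) + 6 * b + 40 ≤ 110 * (N * (b ^ 2 + 1)) := by
    have h5 : N * b ≤ N * b ^ 2 := Nat.mul_le_mul_left _ h1
    ring_nf at *
    omega
  have h6 : N * (b ^ 2 + 1) ≤ k * (N * (b ^ 2 + 1)) := Nat.le_mul_of_pos_left _ hk
  calc k * (b * (b * (20 * N + 12) + 6) + 12) + 2 * (b * (20 * N + 12)) + 6 * b + 40
      ≤ k * (50 * (N * (b ^ 2 + 1))) + 110 * (N * (b ^ 2 + 1)) := by
        have := Nat.mul_le_mul_left k h3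
        omega
    _ ≤ k * (50 * (N * (b ^ 2 + 1))) + 110 * (k * (N * (b ^ 2 + 1))) := by omega
    _ = 160 * (N * k * (b ^ 2 + 1)) := by ring

theorem total_time_le {k t b c : ℕ} (hk : 0 < k) (ht : 0 < t) (hc : 0 < c) :
    3 * k + t * (6 * b + 14) + t * (stageTime k b + 2) + 40 ≤
      300 * (2 ^ k * t * k * (b ^ 2 + k * c) + 1) := by
  have h1 : 1 ≤ k * c := Nat.mul_pos hk hc
  have hN : 1 ≤ 2 ^ k := Nat.one_le_two_pow
  have hs := stageTime_le (b := b) hk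
  have hY : 1 ≤ 2 ^ k * k := Nat.mul_pos hN hk
  have hb : b ≤ b ^ 2 := Nat.le_self_pow (by norm_num) b
  have h2 : b ^ 2 + 1 ≤ 2 ^ k * k * (b ^ 2 + 1) := Nat.le_mul_of_pos_left _ hY
  have h3 : k ≤ t * (2 ^ k * k * (b ^ 2 + 1)) :=
    calc k = 1 * (1 * k * 1) := by ring
      _ ≤ t * (2 ^ k * k * (b ^ 2 + 1)) := by gcongr <;> omega
  have h4 : t * (6 * b + 14) ≤ t * (20 * (2 ^ k * k * (b ^ 2 + 1))) :=
    Nat.mul_le_mul_left _ (by omega)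
  have h5 : t * (stageTime k b + 2) ≤ t * (162 * (2 ^ k * k * (b ^ 2 + 1))) :=
    Nat.mul_le_mul_left _ (by omega)
  have h6 : t * (2 ^ k * k * (b ^ 2 + 1)) ≤ 2 ^ k * t * k * (b ^ 2 + k * c) :=
    calc t * (2 ^ k * k * (b ^ 2 + 1)) = 2 ^ k * t * k * (b ^ 2 + 1) := by ring
      _ ≤ 2 ^ k * t * k * (b ^ 2 + k * c) := by gcongr
  rw [Nat.mul_left_comm] at h4 h5
  omega

end RAM

theorem mainTheorem1 :
    ∃ (P : RAM.Prog) (C c : ℕ),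
      ∀ (bc : ℕ → ℕ), Monotone bc → (∀ l, 1 ≤ bc l) →
      ∀ I : ShuffleInstance, ∃ (s : RAM.State) (T : ℕ),
        P.Runs bc (c * (I.k + Nat.log 2 (I.t + I.b + I.g + 1) + 1))
          (RAM.State.ofInput I.encode) s T ∧
        (I.IsYes → s.reg 0 = 1) ∧ (¬ I.IsYes → s.reg 0 = 0) ∧
        T ≤ C * (2 ^ I.k * I.t * I.k * (I.b ^ 2 + I.k * bc I.k) + 1) := by
  refine ⟨RAM.shuffleProg, 300, 8, fun bc _ hbc I => ?_⟩
  obtain ⟨s, T, hrun, hs, hT⟩ := RAM.wp_shuffleProg (bc := bc) (RAM.addresses_lt I)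
  refine ⟨s, T, hrun, fun h => ?_, fun h => ?_, ?_⟩
  · rw [hs, ShuffleInstance.bit_of_true h]
  · rw [hs, ShuffleInstance.bit_of_false h]
  · rcases hT with hT | ⟨hk, ht, hT⟩
    · omega
    · exact hT.trans (RAM.total_time_le hk ht (hbc _))
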